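/- Let $d\in\{2,3\}$, let $\mathcal T_h$ be a conformal simplicial mesh with elements $K_k$ of a bounded polyhedral domain $\mathcal D\subset\mathbb R^d$, and let $\mathrm{Re}\ge 0$, $\mathrm{Wi}>0$, $0\le\varepsilon<1$. Let $V_h=(\mathbb P_2)^d$ be the continuous vector fields, vanishing on $\partial\mathcal D$, that are polynomial of degree $\le 2$ on each element; $P_h=\mathbb P_{1,disc}$ the functions that are affine on each element (possibly discontinuous); $S_h=(\mathbb P_0)^{d(d+1)/2}$ the symmetric-matrix fields that are constant on each element; and $V_h^0=\{v\in V_h:\int_{\mathcal D}q\,\mathrm{div}\,v=0\ \ \forall q\in P_h\}$. Write $(\nabla u)_{ij}=\partial_j u_i$ and $A:B=\mathrm{tr}(AB^T)$. For a given $(u_h^n,\sigma_h^n)\in V_h\times S_h$ and $\Delta t>0$, one step of the scheme is: find $(u_h^{n+1},p_h^{n+1},\sigma_h^{n+1})\in V_h\times P_h\times S_h$ such that for all $(v,q,\phi)\in V_h\times P_h\times S_h$ $$0=\int_{\mathcal D}\mathrm{Re}\Big(\tfrac{u_h^{n+1}-u_h^n}{\Delta t}+u_h^n\cdot\nabla u_h^{n+1}\Big)\cdot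 v-p_h^{n+1}\mathrm{div}\,v+q\,\mathrm{div}\,u_h^{n+1}+(1-\varepsilon)\nabla u_h^{n+1}:\nabla v+\tfrac{\varepsilon}{\mathrm{Wi}}\sigma_h^{n+1}:\nabla v$$ $$\qquad+\tfrac{\sigma_h^{n+1}-\tilde\sigma}{\Delta t}:\phi-\big((\nabla u_h^{n+1})\sigma_h^{n+1}+\sigma_h^{n+1}(\nabla u_h^{n+1})^T\big):\phi+\tfrac1{\mathrm{Wi}}(\sigma_h^{n+1}-I):\phi\;+\;J(\sigma_h^{n+1},\phi),$$ where * (characteristic method) $\tilde\sigma=\sigma_h^n\circ X^n(t^n)$ and $J=0$, with $X^n(t,\cdot):\mathcal D\to\mathcal D$ the backward flow, $\frac{d}{dt}X^n(t,x)=u_h^n(X^n(t,x))$ on $[t^n,t^n+\Delta t]$, $X^n(t^n+\Delta t,x)=x$; * (discontinuous Galerkin method) $\tilde\sigma=\sigma_h^n$ and $J(\sigma,\phi)=\sum_j\int_{E_j}|u_h^n\cdot n|\,(\sigma^+-\sigma^-):\phi^+$, the sum running over the internal edges (faces if $d=3$) $E_j$ with unit normal $n$, and $\phi^\pm(x)=\lim_{\delta\to0^\pm}\phi(x+\delta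 u_h^n(x))$. The pressure-free form of the scheme, multiplied by $\Delta t$, is: find $(u_h^{n+1},\sigma_h^{n+1})\in V_h^0\times S_h$ such that the equation above, multiplied by $\Delta t$ and without the terms in $p$ and $q$, holds for all $(v,\phi)\in V_h^0\times S_h$; this form makes sense for $\Delta t=0$ as well. **Proposition.** For each of the two methods and any couple $(u_h^n,\sigma_h^n)\in V_h\times S_h$ with $\sigma_h^n$ symmetric positive definite on every element, there is $c_0>0$ (depending on $u_h^n,\sigma_h^n$, the mesh and $\mathrm{Re},\mathrm{Wi},\varepsilon$) such that for all $0\le\Delta t<c_0$: * if $\Delta t>0$, there is exactly one couple $(u_h^{n+1},\sigma_h^{n+1})\in V_h\times S_h$ with $\sigma_h^{n+1}$ symmetric positive definite on every element which, together with some pressure $p_h^{n+1}\in P_h$, solves the scheme; * if $\Delta t>0$ or $\mathrm{Re}>0$, there is exactly one couple $(u_h^{n+1},\sigma_h^{n+1})\in V_h^0\times S_h$ with $\sigma_h^{n+1}$ symmetric positive definite on every element which solves the pressure-free form of the scheme multiplied by $\Delta t$. -/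

import Mathlib

open MeasureTheory Topology Filter Set
open scoped Matrix

noncomputable section

namespace OldroydB

/-- `ℝ^d` with its Euclidean structure. -/
abbrev Space (d : ℕ) : Type := EuclideanSpace ℝ (Fin d)

/-- A conformal simplicial mesh in `ℝ^d`: finitely many nondegenerate `d`-simplices, each given by
its set of `d + 1` vertices, any two of which meet exactly in the (possibly empty) simplex spanned
by their common vertices. -/
structure Mesh (d : ℕ) where
  /-- The vertex sets of the elements `K_k`. -/
  cells : Finset (Finset (Space d))
  card_eq : ∀ s ∈ cells, s.card = d + 1
  indep : ∀ s ∈ cells, AffineIndependent ℝ ((↑) : s → Space d)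
  conforming : ∀ s ∈ cells, ∀ t ∈ cells,
    convexHull ℝ (s : Set (Space d)) ∩ convexHull ℝ (t : Set (Space d)) ⊆
      convexHull ℝ ((s : Set (Space d)) ∩ (t : Set (Space d)))

namespace Mesh

variable {d : ℕ} (M : Mesh d)

/-- The open bounded polyhedral domain tessellated by the mesh: the interior of the union of the
closed elements. -/
def domain : Set (Space d) :=
  interior (⋃ s ∈ M.cells, convexHull ℝ (s : Set (Space d)))

open Classical in
/-- The internal edges (`d = 2`) or faces (`d = 3`) `E_j` of the mesh, given by their vertex sets:
the common facets of two distinct elements. -/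
def internalFacets : Finset (Finset (Space d)) :=
  ((M.cells ×ˢ M.cells).filter fun st => st.1 ≠ st.2 ∧ (st.1 ∩ st.2).card = d).image
    fun st => st.1 ∩ st.2

/-- `v` is, in each coordinate, a polynomial of total degree at most `2` on the set `A`. -/
def IsQuadraticOn (v : Space d → Space d) (A : Set (Space d)) : Prop :=
  ∀ i, ∃ P : MvPolynomial (Fin d) ℝ, P.totalDegree ≤ 2 ∧
    ∀ x ∈ A, v x i = MvPolynomial.eval (fun j => x j) P

/-- The velocity space `(ℙ₂)^d` with homogeneous Dirichlet conditions: continuous vector fields that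
are polynomial of degree at most `2` on each element and vanish on the boundary of the domain.
Fields are extended by `0` outside of the domain. -/
def velocitySpace : Submodule ℝ (Space d → Space d) where
  carrier := {v | Continuous v ∧ (∀ x, x ∉ M.domain → v x = 0) ∧
    ∀ s ∈ M.cells, IsQuadraticOn v (convexHull ℝ (s : Set (Space d)))}
  add_mem' := by
    rintro v w ⟨hv, hv0, hvP⟩ ⟨hw, hw0, hwP⟩
    refine ⟨hv.add hw, fun x hx => by simp [hv0 x hx, hw0 x hx], fun s hs i => ?_⟩
    obtain ⟨P, hP, hPe⟩ := hvP s hs i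
    obtain ⟨Q, hQ, hQe⟩ := hwP s hs i
    refine ⟨P + Q, (MvPolynomial.totalDegree_add P Q).trans (max_le hP hQ), fun x hx => ?_⟩
    simp [hPe x hx, hQe x hx]
  zero_mem' := by
    refine ⟨continuous_const, fun x _ => rfl, fun s _ i => ⟨0, by simp, fun x _ => by simp⟩⟩
  smul_mem' := by
    rintro c v ⟨hv, hv0, hvP⟩
    refine ⟨hv.const_smul c, fun x hx => by simp [hv0 x hx], fun s hs i => ?_⟩
    obtain ⟨P, hP, hPe⟩ := hvP s hs i
    refine ⟨c • P, (MvPolynomial.totalDegree_smul_le c P).trans hP, fun x hx => ?_⟩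
    simp [hPe x hx, MvPolynomial.smul_eval]

/-- The pressure space `ℙ_{1,disc}`: one affine function per element. -/
abbrev PressureSpace : Type := M.cells → (Space d →ᵃ[ℝ] ℝ)

/-- The stress space `(ℙ₀)^{d(d+1)/2}`: one symmetric matrix per element. -/
def stressSpace : Submodule ℝ (M.cells → Matrix (Fin d) (Fin d) ℝ) where
  carrier := {σ | ∀ s, (σ s).IsSymm}
  add_mem' := fun hσ hτ s => (hσ s).add (hτ s)
  zero_mem' := fun _ => Matrix.isSymm_zero
  smul_mem' := fun c _ hσ s => (hσ s).smul c

/-- The elementwise positive definite stress fields. -/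
def IsSPD (σ : M.stressSpace) : Prop := ∀ s, (σ.1 s).PosDef

/-- The scalar field on `ℝ^d` equal to `p s` in the interior of each element `s`
(and to `0` on the null set of the remaining points of the domain). -/
def pressureField (p : M.PressureSpace) (x : Space d) : ℝ :=
  ∑ s : M.cells, (interior (convexHull ℝ (s.1 : Set (Space d)))).indicator (p s) x

/-- The matrix field on `ℝ^d` equal to the constant `σ s` in the interior of each element `s`
(and to `0` on the null set of the remaining points of the domain). -/
def stressField (σ : M.stressSpace) (x : Space d) : Matrix (Fin d) (Fin d) ℝ :=
  ∑ s : M.cells, (interior (convexHull ℝ (s.1 : Set (Space d)))).indicator (fun _ => σ.1 s) x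

end Mesh

section Densities

variable {d : ℕ}

/-- The velocity gradient `(∇u)_{ij} = ∂u_i / ∂x_j`; on the interior of each element it is the
classical gradient of the polynomial field. -/
def grad (u : Space d → Space d) (x : Space d) : Matrix (Fin d) (Fin d) ℝ :=
  Matrix.of fun i j => fderiv ℝ u x (EuclideanSpace.single j 1) i

/-- The divergence `div u = tr ∇u`. -/
def divergence (u : Space d → Space d) (x : Space d) : ℝ := (grad u x).trace

/-- The double contraction `A : B = tr (A Bᵀ)`. -/
def ddot (A B : Matrix (Fin d) (Fin d) ℝ) : ℝ := (A * Bᵀ).trace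

/-- The advection term `u₀ · ∇u = (∇u) u₀`. -/
def convect (u₀ u : Space d → Space d) (x : Space d) : Space d := fderiv ℝ u x (u₀ x)

/-- `Re (u - u₀) · v + (σ - σ₀) : φ`: the increments over one time step, before division
by the time step. -/
def timeDensity (Re : ℝ) (u₀ u v : Space d → Space d)
    (σ₀ σ φ : Space d → Matrix (Fin d) (Fin d) ℝ) (x : Space d) : ℝ :=
  Re * inner ℝ (u x - u₀ x) (v x) + ddot (σ x - σ₀ x) (φ x)

/-- `Re (u₀ · ∇u) · v + (1 - ε) ∇u : ∇v + (ε / Wi) σ : ∇v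
- ((∇u) σ + σ (∇u)ᵀ) : φ + (1 / Wi) (σ - I) : φ`. -/
def spaceDensity (Re Wi ε : ℝ) (u₀ u v : Space d → Space d)
    (σ φ : Space d → Matrix (Fin d) (Fin d) ℝ) (x : Space d) : ℝ :=
  Re * inner ℝ (convect u₀ u x) (v x) + (1 - ε) * ddot (grad u x) (grad v x)
    + ε / Wi * ddot (σ x) (grad v x)
    - ddot (grad u x * σ x + σ x * (grad u x)ᵀ) (φ x)
    + 1 / Wi * ddot (σ x - 1) (φ x)

/-- `- p div v + q div u`. -/
def pressureDensity (p q : Space d → ℝ) (u v : Space d → Space d) (x : Space d) : ℝ :=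
  - p x * divergence v x + q x * divergence u x

end Densities

namespace Mesh

variable {d : ℕ} (M : Mesh d)

/-- The space `(ℙ₂)^d_{div=0}` of the velocities `v` with `∫ q div v = 0` for all `q ∈ ℙ_{1,disc}`. -/
def IsDivFree (v : M.velocitySpace) : Prop :=
  ∀ q : M.PressureSpace, ∫ x in M.domain, M.pressureField q x * divergence v.1 x = 0

/-- `X t x` is the backward flow of the velocity field `u` over a time step of length `Δt`, time
being counted from the beginning of the step (`u` does not depend on time):
`X(·, x)` stays in the domain, `dX/dt = u(X)` on `[0, Δt]` and `X(Δt, x) = x`. -/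
structure IsBackwardFlow (u : Space d → Space d) (Δt : ℝ) (X : ℝ → Space d → Space d) : Prop where
  mapsTo : ∀ x ∈ M.domain, ∀ t ∈ Icc 0 Δt, X t x ∈ M.domain
  ode : ∀ x ∈ M.domain, ∀ t ∈ Icc 0 Δt,
    HasDerivWithinAt (fun r => X r x) (u (X t x)) (Icc 0 Δt) t
  final : ∀ x ∈ M.domain, X Δt x = x

/-- The downstream value `φ⁺(x) = lim_{δ → 0⁺} φ(x + δ u(x))`. -/
def downstream (u : Space d → Space d) (φ : Space d → Matrix (Fin d) (Fin d) ℝ) (x : Space d) :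
    Matrix (Fin d) (Fin d) ℝ :=
  limUnder (𝓝[>] (0 : ℝ)) fun δ => φ (x + δ • u x)

/-- The upstream value `φ⁻(x) = lim_{δ → 0⁻} φ(x + δ u(x))`. -/
def upstream (u : Space d → Space d) (φ : Space d → Matrix (Fin d) (Fin d) ℝ) (x : Space d) :
    Matrix (Fin d) (Fin d) ℝ :=
  limUnder (𝓝[<] (0 : ℝ)) fun δ => φ (x + δ • u x)

/-- `|w · n|` for a unit normal vector `n` to the facet with vertex set `t`: the norm of the
orthogonal projection of `w` to the line orthogonal to the facet. -/
def absNormal (t : Finset (Space d)) (w : Space d) : ℝ :=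
  ‖(vectorSpan ℝ (t : Set (Space d)))ᗮ.starProjection w‖

/-- The upwind term `∑_j ∫_{E_j} |u₀ · n| [σ] : φ⁺` over the internal edges, with `[σ] = σ⁺ - σ⁻`
and the `(d-1)`-dimensional surface measure. -/
def jumpTerm (u₀ : M.velocitySpace) (σ φ : M.stressSpace) : ℝ :=
  ∑ t ∈ M.internalFacets, ∫ x in convexHull ℝ (t : Set (Space d)),
    absNormal t (u₀.1 x) *
      ddot (downstream u₀.1 (M.stressField σ) x - upstream u₀.1 (M.stressField σ) x)
        (downstream u₀.1 (M.stressField φ) x) ∂(Measure.euclideanHausdorffMeasure (d - 1))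

/-- `(u, p, σ)` solves one step, of length `Δt > 0`, of the scheme with the characteristic method,
from the data `(u₀, σ₀)`. -/
def SolvesCharacteristic (Re Wi ε Δt : ℝ) (u₀ : M.velocitySpace) (σ₀ : M.stressSpace)
    (u : M.velocitySpace) (p : M.PressureSpace) (σ : M.stressSpace) : Prop :=
  ∃ X : ℝ → Space d → Space d, M.IsBackwardFlow u₀.1 Δt X ∧
    ∀ (v : M.velocitySpace) (q : M.PressureSpace) (φ : M.stressSpace),
      ∫ x in M.domain,
        (timeDensity Re u₀.1 u.1 v.1 (fun y => M.stressField σ₀ (X 0 y)) (M.stressField σ)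
            (M.stressField φ) x / Δt
          + spaceDensity Re Wi ε u₀.1 u.1 v.1 (M.stressField σ) (M.stressField φ) x
          + pressureDensity (M.pressureField p) (M.pressureField q) u.1 v.1 x) = 0

/-- `(u, p, σ)` solves one step, of length `Δt > 0`, of the scheme with the discontinuous Galerkin
method, from the data `(u₀, σ₀)`. -/
def SolvesDG (Re Wi ε Δt : ℝ) (u₀ : M.velocitySpace) (σ₀ : M.stressSpace)
    (u : M.velocitySpace) (p : M.PressureSpace) (σ : M.stressSpace) : Prop :=
  ∀ (v : M.velocitySpace) (q : M.PressureSpace) (φ : M.stressSpace),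
    (∫ x in M.domain,
      (timeDensity Re u₀.1 u.1 v.1 (M.stressField σ₀) (M.stressField σ) (M.stressField φ) x / Δt
        + spaceDensity Re Wi ε u₀.1 u.1 v.1 (M.stressField σ) (M.stressField φ) x
        + pressureDensity (M.pressureField p) (M.pressureField q) u.1 v.1 x))
      + M.jumpTerm u₀ σ φ = 0

/-- The pressure-free form of the characteristic scheme, with trial and test velocities in
`(ℙ₂)^d_{div=0}`, multiplied by `Δt` so that it makes sense for `Δt = 0` too. -/
def SolvesCharacteristicProj (Re Wi ε Δt : ℝ) (u₀ : M.velocitySpace) (σ₀ : M.stressSpace)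
    (u : M.velocitySpace) (σ : M.stressSpace) : Prop :=
  M.IsDivFree u ∧ ∃ X : ℝ → Space d → Space d, M.IsBackwardFlow u₀.1 Δt X ∧
    ∀ (v : M.velocitySpace) (φ : M.stressSpace), M.IsDivFree v →
      ∫ x in M.domain,
        (timeDensity Re u₀.1 u.1 v.1 (fun y => M.stressField σ₀ (X 0 y)) (M.stressField σ)
            (M.stressField φ) x
          + Δt * spaceDensity Re Wi ε u₀.1 u.1 v.1 (M.stressField σ) (M.stressField φ) x) = 0

/-- The pressure-free form of the discontinuous Galerkin scheme, with trial and test velocities in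
`(ℙ₂)^d_{div=0}`, multiplied by `Δt` so that it makes sense for `Δt = 0` too. -/
def SolvesDGProj (Re Wi ε Δt : ℝ) (u₀ : M.velocitySpace) (σ₀ : M.stressSpace)
    (u : M.velocitySpace) (σ : M.stressSpace) : Prop :=
  M.IsDivFree u ∧ ∀ (v : M.velocitySpace) (φ : M.stressSpace), M.IsDivFree v →
    (∫ x in M.domain,
      (timeDensity Re u₀.1 u.1 v.1 (M.stressField σ₀) (M.stressField σ) (M.stressField φ) x
        + Δt * spaceDensity Re Wi ε u₀.1 u.1 v.1 (M.stressField σ) (M.stressField φ) x))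
      + Δt * M.jumpTerm u₀ σ φ = 0

end Mesh

end OldroydB

end

/-! All spaces are finite-dimensional and `c₀` may depend on the mesh and the data, so every form in
the scheme is bounded and the terms carrying the time step `t` are small perturbations. The abstract
core is `exists_unique_step`; the rest of the proof supplies its hypotheses.

Existence. For a given stress `σ` the velocity equation is linear in `u` and coercive: the Dirichlet
form has factor `t * (1 - ε)`, and for small `t` the mass form absorbs the convection term, which
has no sign since `u₀` need not be divergence-free. Both the forcing by `σ` and the viscous term
carry the factor `t`, so the Lipschitz constant of `σ ↦ u(σ)` does not depend on `t`, even if `Re =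
0`. Inserting `u(σ)` and `σ` in the terms of order `t` of the stress equation gives a map which, for
small `t`, is a contraction of a small ball around `σ₀`. The ball lies in the open set of positive
definite stresses, so the fixed point is admissible.

Uniqueness. A competitor is only known to be positive definite, so an a priori bound is needed.
Testing with `u` and with half of `ε / Wi` times the identity cancels the coupling, because `(G σ +
σ Gᵀ) : I = 2 σ : G` for symmetric `σ`. As the trace of a positive definite matrix bounds its norm,
the upwind term is absorbed and `t ‖u‖²` stays bounded. Hence `t ‖u‖` is of order `√t`, the
quadratic term of the stress equation is small, and testing with `σ` bounds `‖σ‖` independently of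
`t`. The contraction estimate holds on that larger ball and identifies the two solutions.

The two methods differ only in the form of the transported stress and in the upwind form. The former
must tend to `φ ↦ ∫ σ₀ : φ` as `t → 0` (`exists_transportForm`); the latter need only be bilinear
(`exists_jumpForm`). The pressure is recovered by finite-dimensional duality
(`exists_pressure_iff_solvesResidual`). -/

noncomputable section

namespace OldroydB

/-! ### The implicit step in finite-dimensional inner product spaces -/

section AbstractStep

variable {V S : Type*} [NormedAddCommGroup V] [InnerProductSpace ℝ V] [FiniteDimensional ℝ V]
  [NormedAddCommGroup S] [InnerProductSpace ℝ S] [FiniteDimensional ℝ S]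

/-- A linear form on a finite-dimensional space is bounded. -/
theorem exists_linear_bound (f : V →ₗ[ℝ] ℝ) : ∃ C : ℝ, 0 ≤ C ∧ ∀ x, |f x| ≤ C * ‖x‖ :=
  ⟨‖LinearMap.toContinuousLinearMap f‖, by positivity,
    fun v => (LinearMap.toContinuousLinearMap f).le_opNorm v⟩

/-- A bilinear map on finite-dimensional spaces is bounded. -/
theorem exists_bilinear_bound {G : Type*} [NormedAddCommGroup G] [NormedSpace ℝ G]
    (f : V →ₗ[ℝ] S →ₗ[ℝ] G) : ∃ C : ℝ, 0 ≤ C ∧ ∀ x y, ‖f x y‖ ≤ C * ‖x‖ * ‖y‖ := by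
  let g : V →L[ℝ] S →L[ℝ] G := LinearMap.toContinuousLinearMap
    ((LinearMap.toContinuousLinearMap (𝕜 := ℝ) (E := S) (F' := G)).toLinearMap ∘ₗ f)
  exact ⟨‖g‖, by positivity, fun x y => g.le_opNorm₂ x y⟩

/-- A trilinear form on finite-dimensional spaces is bounded. -/
theorem exists_trilinear_bound (f : V →ₗ[ℝ] S →ₗ[ℝ] S →ₗ[ℝ] ℝ) :
    ∃ C : ℝ, 0 ≤ C ∧ ∀ x y z, |f x y z| ≤ C * ‖x‖ * ‖y‖ * ‖z‖ := by
  obtain ⟨C, hC, h⟩ := exists_bilinear_bound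
    (f.compr₂ (LinearMap.toContinuousLinearMap (𝕜 := ℝ) (E := S) (F' := ℝ)).toLinearMap)
  refine ⟨C, hC, fun x y z => ?_⟩
  have h1 := (LinearMap.toContinuousLinearMap (f x y)).le_opNorm z
  exact h1.trans (mul_le_mul_of_nonneg_right (h x y) (norm_nonneg z))

/-- A positive definite quadratic form on a finite-dimensional space is coercive. -/
theorem exists_coercive_bound {E : Type*} [NormedAddCommGroup E] [NormedSpace ℝ E]
    [FiniteDimensional ℝ E] (m : E →ₗ[ℝ] E →ₗ[ℝ] ℝ) (hm : ∀ v, v ≠ 0 → 0 < m v v) :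
    ∃ c : ℝ, 0 < c ∧ ∀ v, c * ‖v‖ ^ 2 ≤ m v v := by
  let g : E →L[ℝ] E →L[ℝ] ℝ := LinearMap.toContinuousLinearMap
    ((LinearMap.toContinuousLinearMap (𝕜 := ℝ) (E := E) (F' := ℝ)).toLinearMap ∘ₗ m)
  have hg : Continuous fun v => g v v := by fun_prop
  rcases subsingleton_or_nontrivial E with hE | hE
  · exact ⟨1, one_pos, fun v => by simp [Subsingleton.elim v 0]⟩
  obtain ⟨x, hx, hmin⟩ := (isCompact_sphere (0 : E) 1).exists_isMinOn
    (NormedSpace.sphere_nonempty.2 zero_le_one) hg.continuousOn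
  have hx0 : x ≠ 0 := by
    rintro rfl
    simp at hx
  refine ⟨m x x, hm x hx0, fun v => ?_⟩
  rcases eq_or_ne v 0 with rfl | hv
  · simp
  have hv' : ‖v‖ ≠ 0 := norm_ne_zero_iff.2 hv
  have h1 : ‖v‖⁻¹ • v ∈ Metric.sphere (0 : E) 1 := by
    simp [norm_smul, inv_mul_cancel₀ hv']
  have h2 : m x x ≤ m (‖v‖⁻¹ • v) (‖v‖⁻¹ • v) := hmin h1
  simp only [map_smul, LinearMap.smul_apply, smul_eq_mul] at h2
  have h3 : ‖v‖⁻¹ * (‖v‖⁻¹ * m v v) * ‖v‖ ^ 2 = m v v := by field_simp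
  calc m x x * ‖v‖ ^ 2 ≤ ‖v‖⁻¹ * (‖v‖⁻¹ * m v v) * ‖v‖ ^ 2 := by gcongr
    _ = m v v := h3

/-- A coercive bilinear form on a finite-dimensional space represents every linear form. -/
theorem exists_solution_of_coercive (A : V →ₗ[ℝ] V →ₗ[ℝ] ℝ) {D : ℝ} (hD : 0 < D)
    (hA : ∀ v, D * ‖v‖ ^ 2 ≤ A v v) (f : V →ₗ[ℝ] ℝ) : ∃ u, A u = f := by
  have hinj : Function.Injective A := by
    refine (injective_iff_map_eq_zero A).2 fun v hv => ?_
    have h := hA v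
    rw [hv, LinearMap.zero_apply] at h
    have h2 : ‖v‖ ^ 2 ≤ 0 := by nlinarith [sq_nonneg ‖v‖]
    exact norm_eq_zero.1 (pow_eq_zero_iff two_ne_zero |>.1 (le_antisymm h2 (sq_nonneg _)))
  exact (LinearMap.injective_iff_surjective_of_finrank_eq_finrank
    (Subspace.dual_finrank_eq (K := ℝ) (V := V)).symm).1 hinj f

/-- Weak convergence of linear forms on a finite-dimensional space is uniform on the unit ball. -/
theorem eventually_abs_sub_le_of_tendsto {ι : Type*} {l : Filter ι} (s : ι → S →ₗ[ℝ] ℝ) (σ₀ : S)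
    (hs : ∀ φ, Tendsto (fun t => s t φ) l (𝓝 (inner ℝ σ₀ φ))) {ρ : ℝ} (hρ : 0 < ρ) :
    ∀ᶠ t in l, ∀ φ, |s t φ - inner ℝ σ₀ φ| ≤ ρ * ‖φ‖ := by
  let b := stdOrthonormalBasis ℝ S
  -- The `+ 1` keeps the divisor positive when the space is trivial.
  set n : ℝ := Module.finrank ℝ S + 1 with hn
  have hn0 : 0 < n := by positivity
  have h1 : ∀ i, ∀ᶠ t in l, |s t (b i) - inner ℝ σ₀ (b i)| < ρ / n := fun i => by
    have := (hs (b i)).sub_const (inner ℝ σ₀ (b i))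
    rw [sub_self] at this
    have h := this.abs
    rw [abs_zero] at h
    exact h.eventually_lt_const (by positivity)
  filter_upwards [eventually_all.2 h1] with t ht φ
  have h2 : s t φ - inner ℝ σ₀ φ = ∑ i, inner ℝ (b i) φ * (s t (b i) - inner ℝ σ₀ (b i)) := by
    conv_lhs => rw [← b.sum_repr' φ]
    simp only [map_sum, map_smul, smul_eq_mul, inner_sum, inner_smul_right, mul_sub,
      Finset.sum_sub_distrib]
  rw [h2]
  calc _ ≤ ∑ i, |inner ℝ (b i) φ * (s t (b i) - inner ℝ σ₀ (b i))| :=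
        Finset.abs_sum_le_sum_abs _ _
    _ ≤ ∑ _i : Fin (Module.finrank ℝ S), ‖φ‖ * (ρ / n) := by
        refine Finset.sum_le_sum fun i _ => ?_
        rw [abs_mul]
        refine mul_le_mul ?_ (ht i).le (abs_nonneg _) (norm_nonneg _)
        simpa using abs_real_inner_le_norm (b i) φ
    _ = (Module.finrank ℝ S / n) * (ρ * ‖φ‖) := by
        rw [Finset.sum_const, Finset.card_univ, Fintype.card_fin, nsmul_eq_mul]; ring
    _ ≤ 1 * (ρ * ‖φ‖) := by
        gcongr
        rw [div_le_one hn0]; linarith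
    _ = ρ * ‖φ‖ := one_mul _

theorem norm_le_of_sq_le_mul {E : Type*} [NormedAddCommGroup E] (x : E) (C : ℝ) (hC : 0 ≤ C)
    (h : ‖x‖ ^ 2 ≤ C * ‖x‖) : ‖x‖ ≤ C := by
  rcases (norm_nonneg x).eq_or_lt with h0 | h0
  · rwa [← h0]
  · nlinarith

/-- The weak form of one implicit step, tested with `(v, φ)`. -/
def stepForm (m c : V →ₗ[ℝ] V →ₗ[ℝ] ℝ) (ℓ : V →ₗ[ℝ] ℝ) (b : S →ₗ[ℝ] V →ₗ[ℝ] ℝ)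
    (B : V →ₗ[ℝ] S →ₗ[ℝ] S →ₗ[ℝ] ℝ) (e : S) (j : S →ₗ[ℝ] S →ₗ[ℝ] ℝ) (Re κ η θ t : ℝ)
    (s : S →ₗ[ℝ] ℝ) (u : V) (σ : S) (v : V) (φ : S) : ℝ :=
  Re * (m u v - ℓ v) + (inner ℝ σ φ - s φ)
    + t * (Re * c u v + κ * inner ℝ u v + η * b σ v - B u σ φ
      + θ * (inner ℝ σ φ - inner ℝ e φ) + j σ φ)

-- Solving for the velocity first leaves a fixed-point problem for the stress alone: contraction
-- near `σ₀` gives existence, and an energy bound on `P` gives uniqueness. In the application `e` is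
-- the identity, `P` the positive definite stresses, and `hB` the identity that cancels the
-- coupling. Neither `c` nor `j` is assumed to have a sign.
set_option maxHeartbeats 4000000 in
theorem exists_unique_step (m c : V →ₗ[ℝ] V →ₗ[ℝ] ℝ) (hm : ∀ v, v ≠ 0 → 0 < m v v)
    (ℓ : V →ₗ[ℝ] ℝ) (b : S →ₗ[ℝ] V →ₗ[ℝ] ℝ) (B : V →ₗ[ℝ] S →ₗ[ℝ] S →ₗ[ℝ] ℝ) (e : S)
    (hB : ∀ v σ, B v σ e = 2 * b σ v) (j : S →ₗ[ℝ] S →ₗ[ℝ] ℝ) (P : Set S) (σ₀ : S)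
    {r₁ : ℝ} (hr₁ : 0 < r₁) (hball : ∀ σ, ‖σ - σ₀‖ ≤ r₁ → σ ∈ P) (K : ℝ) (hPK : ∀ σ ∈ P, ‖σ‖ ≤ K * inner ℝ σ e) (hPe : ∀ σ ∈ P, 0 ≤ inner ℝ σ e)
    (s : ℝ → S →ₗ[ℝ] ℝ) (hs : ∀ φ, Tendsto (fun t => s t φ) (𝓝[≥] 0) (𝓝 (inner ℝ σ₀ φ)))
    {Re κ η θ : ℝ} (hRe : 0 ≤ Re) (hκ : 0 < κ) (hη : 0 ≤ η) (hθ : 0 ≤ θ) :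
    ∃ c₀ : ℝ, 0 < c₀ ∧ ∀ t, 0 ≤ t → t < c₀ → (0 < t ∨ 0 < Re) → ∃! w : V × S,
      w.2 ∈ P ∧ ∀ v φ, stepForm m c ℓ b B e j Re κ η θ t (s t) w.1 w.2 v φ = 0 := by
  obtain ⟨cm, hcm, hm'⟩ := exists_coercive_bound m hm
  obtain ⟨Cc, hCc, hc⟩ := exists_bilinear_bound c
  obtain ⟨Cb, hCb, hb⟩ := exists_bilinear_bound b
  obtain ⟨CB, hCB, hBb⟩ := exists_trilinear_bound B
  obtain ⟨Cj, hCj, hj⟩ := exists_bilinear_bound j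
  obtain ⟨Cl, hCl, hl⟩ := exists_linear_bound ℓ
  set r : ℝ := min r₁ 1 with hr
  have hr0 : 0 < r := lt_min hr₁ one_pos
  have hr1 : r ≤ 1 := min_le_right _ _
  have hballP : ∀ σ, ‖σ - σ₀‖ ≤ r → σ ∈ P := fun σ h =>
    hball σ (h.trans (min_le_left _ _))
  -- `R` is the a priori bound on the stress; the factor `2` appears after half of `‖σ‖ ^ 2` is
  -- absorbed. It also bounds the stresses in the ball of radius `r ≤ 1` around `σ₀`.
  set R : ℝ := 2 * (‖σ₀‖ + 1 + θ * ‖e‖) with hR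
  have hRσ : ‖σ₀‖ + 1 ≤ R := by
    have := norm_nonneg σ₀
    have : 0 ≤ θ * ‖e‖ := by positivity
    linarith
  have hR0 : 0 ≤ R := by linarith [norm_nonneg σ₀]
  set U₀ : ℝ := 2 * Cl / cm with hU₀
  set U₁ : ℝ := η * Cb / κ with hU₁
  have hU₀' : 0 ≤ U₀ := by positivity
  have hU₁' : 0 ≤ U₁ := by positivity
  set U : ℝ := U₀ + U₁ * R with hU
  have hU' : 0 ≤ U := by positivity
  set K' : ℝ := max K 0
  set E₀ : ℝ := Re * (Cl ^ 2 / (2 * cm)) + η / 2 * ((‖σ₀‖ + 1) * ‖e‖ + θ * ‖e‖ ^ 2) with hE₀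
  have hE₀' : 0 ≤ E₀ := by positivity
  -- the total size of the terms of order `t` in the stress equation
  set Q : ℝ := CB * U * R + θ * (R + ‖e‖) + Cj * R with hQ
  set Λ : ℝ := CB * (U₁ * R + U) + θ + Cj with hΛ
  have hQ' : 0 ≤ Q := by positivity
  have hΛ' : 0 ≤ Λ := by positivity
  have small : ∀ A : ℝ, ∀ x : ℝ, 0 < x → ∀ᶠ t in 𝓝[≥] (0 : ℝ), t * A < x := fun A x hx => by
    have h : Tendsto (fun t : ℝ => t * A) (𝓝[≥] 0) (𝓝 (0 * A)) :=
      ((continuous_id.mul continuous_const).tendsto _).mono_left nhdsWithin_le_nhds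
    rw [zero_mul] at h
    exact h.eventually_lt_const hx
  -- In order: convection is absorbed by the mass; `t < 1`; the term `j` is absorbed when testing
  -- with `σ`, then when testing with `e`; the small ball is mapped to itself; the map contracts;
  -- the quadratic term is absorbed in the a priori bound.
  have hev : ∀ᶠ t in 𝓝[≥] (0 : ℝ), (t * Cc < cm / 2 ∧ t * 1 < 1 ∧ t * Cj < 1 / 4 ∧
      t * (Cj * K' * ‖e‖) < 1 / 2 ∧ t * Q < r / 2 ∧ t * Λ < 1 / 2 ∧
      t * (CB ^ 2 * (E₀ / κ)) < 1 / 16) ∧ ∀ φ, |s t φ - inner ℝ σ₀ φ| ≤ r / 2 * ‖φ‖ :=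
    ((small _ _ (by positivity)).and ((small _ _ one_pos).and ((small _ _ (by norm_num)).and
      ((small _ _ (by norm_num)).and ((small _ _ (by positivity)).and
      ((small _ _ (by norm_num)).and (small _ _ (by norm_num)))))))).and
      (eventually_abs_sub_le_of_tendsto s σ₀ hs (by positivity))
  obtain ⟨c₀, hc₀, hsub⟩ := (mem_nhdsGE_iff_exists_Ico_subset).1 hev
  refine ⟨c₀, hc₀, fun t ht0 htc htRe => ?_⟩
  obtain ⟨⟨h1, h2, h3, h4, h5, h6, h7⟩, hst⟩ := hsub ⟨ht0, htc⟩
  set D : ℝ := Re * cm / 2 + t * κ with hD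
  have hD0 : 0 < D := by
    rcases htRe with h | h
    · have : 0 ≤ Re * cm / 2 := by positivity
      have : 0 < t * κ := by positivity
      linarith
    · have : 0 < Re * cm / 2 := by positivity
      have : 0 ≤ t * κ := by positivity
      linarith
  -- Half of the mass pays for the convection. Both carry the factor `Re`, so `Re = 0` does no harm,
  -- and `D` is positive if `t` or `Re` is.
  have hcoer : ∀ v, D * ‖v‖ ^ 2 ≤ Re * m v v + t * (Re * c v v + κ * inner ℝ v v) := fun v => by
    have e1 := hm' v
    have e2 := (abs_le.1 (hc v v)).1
    rw [real_inner_self_eq_norm_sq]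
    have e3 : Re * (cm * ‖v‖ ^ 2) ≤ Re * m v v := mul_le_mul_of_nonneg_left e1 hRe
    have e4 : t * Re * -(Cc * ‖v‖ * ‖v‖) ≤ t * Re * c v v :=
      mul_le_mul_of_nonneg_left e2 (by positivity)
    have e5 : (t * Cc) * (Re * ‖v‖ ^ 2) ≤ cm / 2 * (Re * ‖v‖ ^ 2) :=
      mul_le_mul_of_nonneg_right h1.le (by positivity)
    rw [hD]
    linarith
  -- The multiplier `x` of the data is `1` for the equation itself and `0` for a difference of two
  -- solutions, so a single estimate serves for both.
  let velEq : V → S → ℝ → Prop := fun u σ x => ∀ v,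
    Re * (m u v - x * ℓ v) + t * (Re * c u v + κ * inner ℝ u v + η * b σ v) = 0
  -- The data are weighed against the mass part `Re * cm / 2` of `D` and the stress against the
  -- viscous part `t * κ`. The factors `Re` and `t` cancel, so the bound is independent of both.
  have vel_bound : ∀ u σ x, 0 ≤ x → velEq u σ x → ‖u‖ ≤ x * U₀ + U₁ * ‖σ‖ := by
    intro u σ x hx h
    have e1 := h u
    have e2 := hcoer u
    have e3 : Re * x * ℓ u ≤ Re * x * (Cl * ‖u‖) :=
      mul_le_mul_of_nonneg_left (abs_le.1 (hl u)).2 (by positivity)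
    have e4 : t * η * -(Cb * ‖σ‖ * ‖u‖) ≤ t * η * b σ u :=
      mul_le_mul_of_nonneg_left (abs_le.1 (hb σ u)).1 (by positivity)
    have e5 : D * ‖u‖ ^ 2 ≤ (Re * x * Cl + t * η * Cb * ‖σ‖) * ‖u‖ := by linarith
    have e6 : Re * x * Cl ≤ D * (x * U₀) := by
      have : Re * x * Cl = Re * cm / 2 * (x * U₀) := by rw [hU₀]; field_simp
      rw [this]
      refine mul_le_mul_of_nonneg_right ?_ (by positivity)
      have : 0 ≤ t * κ := by positivity
      linarith
    have e7 : t * η * Cb * ‖σ‖ ≤ D * (U₁ * ‖σ‖) := by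
      have : t * η * Cb * ‖σ‖ = t * κ * (U₁ * ‖σ‖) := by rw [hU₁]; field_simp
      rw [this]
      refine mul_le_mul_of_nonneg_right ?_ (by positivity)
      have : 0 ≤ Re * cm / 2 := by positivity
      linarith
    refine norm_le_of_sq_le_mul u _ (by positivity) (le_of_mul_le_mul_left ?_ hD0)
    calc D * ‖u‖ ^ 2 ≤ (Re * x * Cl + t * η * Cb * ‖σ‖) * ‖u‖ := e5
      _ ≤ (D * (x * U₀) + D * (U₁ * ‖σ‖)) * ‖u‖ := by gcongr
      _ = _ := by ring
  have vel_exists : ∀ σ, ∃ u, velEq u σ 1 := fun σ => by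
    obtain ⟨u, hu⟩ := exists_solution_of_coercive (Re • m + t • (Re • c + κ • innerₗ V)) hD0
      (fun v => by simpa [mul_add] using hcoer v) (Re • ℓ - (t * η) • b σ)
    refine ⟨u, fun v => ?_⟩
    have := LinearMap.congr_fun hu v
    simp at this
    linarith
  have vel_sub : ∀ u₁ u₂ σ₁ σ₂, velEq u₁ σ₁ 1 → velEq u₂ σ₂ 1 → velEq (u₁ - u₂) (σ₁ - σ₂) 0 := by
    intro u₁ u₂ σ₁ σ₂ e1 e2 v
    have e1 := e1 v
    have e2 := e2 v
    simp only [map_sub, LinearMap.sub_apply, inner_sub_left]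
    linarith
  let stressEq : V → S → S → Prop := fun u σ ρ => ∀ φ,
    inner ℝ ρ φ = s t φ + t * (B u σ φ - θ * (inner ℝ σ φ - inner ℝ e φ) - j σ φ)
  have step_iff : ∀ u σ, (∀ v φ, stepForm m c ℓ b B e j Re κ η θ t (s t) u σ v φ = 0) ↔
      velEq u σ 1 ∧ stressEq u σ σ := by
    intro u σ
    refine ⟨fun h => ⟨fun v => ?_, fun φ => ?_⟩, fun h v φ => ?_⟩
    · have := h v 0
      simp [stepForm] at this
      linarith
    · have := h 0 φ
      simp [stepForm] at this
      linarith
    · have e1 := h.1 v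
      have e2 := h.2 φ
      unfold stepForm
      linarith
  have stress_near : ∀ u σ ρ, ‖u‖ ≤ U → ‖σ‖ ≤ R → stressEq u σ ρ → ‖ρ - σ₀‖ ≤ r := by
    intro u σ ρ hu hσ h
    refine norm_le_of_sq_le_mul _ _ hr0.le ?_
    set φ := ρ - σ₀ with hφ
    have e1 := h φ
    have e2 := (abs_le.1 (hst φ)).2
    have e3 : ‖φ‖ ^ 2 = inner ℝ ρ φ - inner ℝ σ₀ φ := by
      rw [← inner_sub_left, ← hφ, real_inner_self_eq_norm_sq]
    have e4 : B u σ φ ≤ CB * U * R * ‖φ‖ := (abs_le.1 (hBb u σ φ)).2.trans (by gcongr)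
    have e5 : -(R * ‖φ‖) ≤ inner ℝ σ φ := (neg_le_neg (by gcongr)).trans
      (abs_le.1 (abs_real_inner_le_norm σ φ)).1
    have e6 : inner ℝ e φ ≤ ‖e‖ * ‖φ‖ := real_inner_le_norm e φ
    have e7 : -(Cj * R * ‖φ‖) ≤ j σ φ := (neg_le_neg (by gcongr)).trans (abs_le.1 (hj σ φ)).1
    have e8 : θ * (inner ℝ e φ - inner ℝ σ φ) ≤ θ * ((R + ‖e‖) * ‖φ‖) :=
      mul_le_mul_of_nonneg_left (by linarith) hθ
    have e9 : t * (B u σ φ - θ * (inner ℝ σ φ - inner ℝ e φ) - j σ φ) ≤ t * (Q * ‖φ‖) :=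
      mul_le_mul_of_nonneg_left (by rw [hQ]; linarith) ht0
    have e10 : t * Q * ‖φ‖ ≤ r / 2 * ‖φ‖ := mul_le_mul_of_nonneg_right h5.le (norm_nonneg _)
    linarith
  have stress_contr : ∀ u₁ u₂ σ₁ σ₂ ρ₁ ρ₂, velEq u₁ σ₁ 1 → velEq u₂ σ₂ 1 → ‖u₁‖ ≤ U →
      ‖σ₂‖ ≤ R → stressEq u₁ σ₁ ρ₁ → stressEq u₂ σ₂ ρ₂ → ‖ρ₁ - ρ₂‖ ≤ 1 / 2 * ‖σ₁ - σ₂‖ := by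
    intro u₁ u₂ σ₁ σ₂ ρ₁ ρ₂ hu₁ hu₂ hU₁ hσ₂ hρ₁ hρ₂
    have hw : ‖u₁ - u₂‖ ≤ U₁ * ‖σ₁ - σ₂‖ := by
      simpa using vel_bound _ _ _ le_rfl (vel_sub _ _ _ _ hu₁ hu₂)
    refine norm_le_of_sq_le_mul _ _ (by positivity) ?_
    set φ := ρ₁ - ρ₂ with hφ
    set τ := σ₁ - σ₂ with hτ
    have e1 := hρ₁ φ
    have e2 := hρ₂ φ
    have e3 : ‖φ‖ ^ 2 = inner ℝ ρ₁ φ - inner ℝ ρ₂ φ := by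
      rw [← inner_sub_left, ← hφ, real_inner_self_eq_norm_sq]
    have e4 : B u₁ σ₁ φ - B u₂ σ₂ φ = B u₁ τ φ + B (u₁ - u₂) σ₂ φ := by
      rw [hτ]
      simp
    have e5 : B u₁ τ φ ≤ CB * U * ‖τ‖ * ‖φ‖ := (abs_le.1 (hBb _ _ _)).2.trans (by gcongr)
    have e6 : B (u₁ - u₂) σ₂ φ ≤ CB * (U₁ * ‖τ‖) * R * ‖φ‖ :=
      (abs_le.1 (hBb _ _ _)).2.trans (by gcongr)
    have e7 : inner ℝ σ₂ φ - inner ℝ σ₁ φ ≤ ‖τ‖ * ‖φ‖ := by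
      have := (abs_le.1 (abs_real_inner_le_norm τ φ)).1
      rw [hτ, inner_sub_left] at this
      linarith
    have e8 : j σ₂ φ - j σ₁ φ ≤ Cj * ‖τ‖ * ‖φ‖ := by
      have := (abs_le.1 (hj τ φ)).1
      rw [hτ, map_sub j, LinearMap.sub_apply] at this
      linarith
    have e9 : θ * (inner ℝ σ₂ φ - inner ℝ σ₁ φ) ≤ θ * (‖τ‖ * ‖φ‖) :=
      mul_le_mul_of_nonneg_left e7 hθ
    have e10 : t * (B u₁ σ₁ φ - B u₂ σ₂ φ + θ * (inner ℝ σ₂ φ - inner ℝ σ₁ φ)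
        + (j σ₂ φ - j σ₁ φ)) ≤ t * (Λ * (‖τ‖ * ‖φ‖)) :=
      mul_le_mul_of_nonneg_left (by rw [e4, hΛ]; linarith) ht0
    have e11 : t * Λ * (‖τ‖ * ‖φ‖) ≤ 1 / 2 * (‖τ‖ * ‖φ‖) :=
      mul_le_mul_of_nonneg_right h6.le (by positivity)
    linarith
  have apriori : ∀ u σ, σ ∈ P → velEq u σ 1 → stressEq u σ σ → ‖σ‖ ≤ R := by
    intro u σ hσP hv hσ
    have i0 := hPe σ hσP
    have hste : s t e ≤ (‖σ₀‖ + 1) * ‖e‖ := by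
      have e1 := (abs_le.1 (hst e)).2
      have e2 := real_inner_le_norm σ₀ e
      have e3 : r / 2 * ‖e‖ ≤ 1 * ‖e‖ := mul_le_mul_of_nonneg_right (by linarith) (norm_nonneg _)
      linarith
    have hstσ : s t σ ≤ (‖σ₀‖ + 1) * ‖σ‖ := by
      have e1 := (abs_le.1 (hst σ)).2
      have e2 := real_inner_le_norm σ₀ σ
      have e3 : r / 2 * ‖σ‖ ≤ 1 * ‖σ‖ := mul_le_mul_of_nonneg_right (by linarith) (norm_nonneg _)
      linarith
    -- The velocity equation tested with `u` plus `η / 2` times the stress equation tested with `e`: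
    -- by `hB` the terms in `b σ u` cancel. Young's inequality spends the remaining half of the mass
    -- on `ℓ u`.
    have energy : t * κ * ‖u‖ ^ 2 ≤ E₀ := by
      have e1 := hv u
      have e2 := hσ e
      rw [hB, real_inner_self_eq_norm_sq] at e2
      have e3 := hcoer u
      have e4 : Re * ℓ u ≤ Re * (cm / 2 * ‖u‖ ^ 2 + Cl ^ 2 / (2 * cm)) := by
        refine mul_le_mul_of_nonneg_left ((abs_le.1 (hl u)).2.trans ?_) hRe
        have : 0 ≤ (cm * ‖u‖ - Cl) ^ 2 / (2 * cm) := by positivity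
        have h' : (cm * ‖u‖ - Cl) ^ 2 / (2 * cm)
            = cm / 2 * ‖u‖ ^ 2 + Cl ^ 2 / (2 * cm) - Cl * ‖u‖ := by
          field_simp
          ring
        linarith
      -- Here membership in `P` is essential: `‖σ‖` is bounded by `inner ℝ σ e`, half of which pays
      -- for the term in `j`.
      have e5 : -(1 / 2 * inner ℝ σ e) ≤ t * j σ e := by
        have f1 := (abs_le.1 (hj σ e)).1
        have f2 : ‖σ‖ ≤ K' * inner ℝ σ e :=
          (hPK σ hσP).trans (mul_le_mul_of_nonneg_right (le_max_left _ _) i0)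
        have f3 : Cj * ‖σ‖ * ‖e‖ ≤ Cj * (K' * inner ℝ σ e) * ‖e‖ := by gcongr
        have f4 : t * -(Cj * (K' * inner ℝ σ e) * ‖e‖) ≤ t * j σ e :=
          mul_le_mul_of_nonneg_left (by linarith) ht0
        have f5 : t * (Cj * K' * ‖e‖) * inner ℝ σ e ≤ 1 / 2 * inner ℝ σ e :=
          mul_le_mul_of_nonneg_right h4.le i0
        linarith
      have e6 : 0 ≤ t * θ * inner ℝ σ e := by positivity
      have e7 : t * (θ * ‖e‖ ^ 2) ≤ 1 * (θ * ‖e‖ ^ 2) :=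
        mul_le_mul_of_nonneg_right (by linarith) (by positivity)
      have e8 : -(t * b σ u) * 2 ≤ (‖σ₀‖ + 1) * ‖e‖ + θ * ‖e‖ ^ 2 := by linarith
      have e9 : η / 2 * (-(t * b σ u) * 2) ≤ η / 2 * ((‖σ₀‖ + 1) * ‖e‖ + θ * ‖e‖ ^ 2) :=
        mul_le_mul_of_nonneg_left e8 (by positivity)
      rw [hE₀]
      rw [hD] at e3
      linarith
    -- The energy bounds only `t * ‖u‖ ^ 2`; multiplying by one more factor `t` makes `(t * ‖u‖) ^
    -- 2` small.
    have htu : t * ‖u‖ * CB ≤ 1 / 4 := by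
      have e1 : ‖u‖ ^ 2 * t ≤ E₀ / κ := by
        rw [le_div_iff₀ hκ]
        linarith
      have e2 : (t * ‖u‖ * CB) ^ 2 ≤ (1 / 4) ^ 2 :=
        calc (t * ‖u‖ * CB) ^ 2 = t * CB ^ 2 * (‖u‖ ^ 2 * t) := by ring
          _ ≤ t * CB ^ 2 * (E₀ / κ) := by gcongr
          _ = t * (CB ^ 2 * (E₀ / κ)) := by ring
          _ ≤ (1 / 4) ^ 2 := by linarith
      exact abs_le_of_sq_le_sq' e2 (by norm_num) |>.2
    refine norm_le_of_sq_le_mul _ _ hR0 ?_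
    have e1 := hσ σ
    rw [real_inner_self_eq_norm_sq] at e1
    have e2 : t * B u σ σ ≤ 1 / 4 * ‖σ‖ ^ 2 :=
      calc t * B u σ σ ≤ t * (CB * ‖u‖ * ‖σ‖ * ‖σ‖) :=
            mul_le_mul_of_nonneg_left (abs_le.1 (hBb u σ σ)).2 ht0
        _ = t * ‖u‖ * CB * ‖σ‖ ^ 2 := by ring
        _ ≤ _ := by gcongr
    have e3 : -(1 / 4 * ‖σ‖ ^ 2) ≤ t * j σ σ :=
      calc -(1 / 4 * ‖σ‖ ^ 2) ≤ -(t * Cj * ‖σ‖ ^ 2) := neg_le_neg (by gcongr)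
        _ = t * -(Cj * ‖σ‖ * ‖σ‖) := by ring
        _ ≤ _ := mul_le_mul_of_nonneg_left (abs_le.1 (hj σ σ)).1 ht0
    have e4 : t * (θ * inner ℝ e σ) ≤ θ * ‖e‖ * ‖σ‖ :=
      calc t * (θ * inner ℝ e σ) ≤ t * (θ * (‖e‖ * ‖σ‖)) := by
            gcongr
            exact real_inner_le_norm e σ
        _ ≤ 1 * (θ * (‖e‖ * ‖σ‖)) := mul_le_mul_of_nonneg_right (by linarith) (by positivity)
        _ = _ := by ring
    have e5 : 0 ≤ t * (θ * ‖σ‖ ^ 2) := by positivity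
    rw [hR]
    linarith
  choose u hu using vel_exists
  have stress_exists : ∀ σ, ∃ ρ, stressEq (u σ) σ ρ := fun σ => by
    let f : S →ₗ[ℝ] ℝ := s t + t • (B (u σ) σ - θ • (innerₗ S σ - innerₗ S e) - j σ)
    refine ⟨(InnerProductSpace.toDual ℝ S).symm (LinearMap.toContinuousLinearMap f), fun φ => ?_⟩
    rw [InnerProductSpace.toDual_symm_apply]
    simp [f]
  choose T hT using stress_exists
  have norm_le_R : ∀ σ, ‖σ - σ₀‖ ≤ r → ‖σ‖ ≤ R := fun σ h => by
    have := norm_add_le (σ - σ₀) σ₀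
    rw [sub_add_cancel] at this
    linarith
  have u_le : ∀ σ, ‖σ‖ ≤ R → ‖u σ‖ ≤ U := fun σ h => by
    have := vel_bound _ _ _ zero_le_one (hu σ)
    have h' : U₁ * ‖σ‖ ≤ U₁ * R := by gcongr
    linarith
  have hmaps : MapsTo T (Metric.closedBall σ₀ r) (Metric.closedBall σ₀ r) := fun σ hσ => by
    rw [mem_closedBall_iff_norm] at hσ ⊢
    exact stress_near _ _ _ (u_le σ (norm_le_R σ hσ)) (norm_le_R σ hσ) (hT σ)
  have hcontr : ContractingWith (1 / 2) (hmaps.restrict T _ _) := by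
    refine ⟨by norm_num, LipschitzWith.of_dist_le_mul fun x y => ?_⟩
    have hx := norm_le_R x.1 (mem_closedBall_iff_norm.1 x.2)
    have hy := norm_le_R y.1 (mem_closedBall_iff_norm.1 y.2)
    rw [Subtype.dist_eq, Subtype.dist_eq, dist_eq_norm, dist_eq_norm]
    simpa using stress_contr _ _ _ _ _ _ (hu x) (hu y) (u_le _ hx) hy (hT x) (hT y)
  obtain ⟨σ, hσ, hfix, -⟩ := hcontr.exists_fixedPoint' Metric.isClosed_closedBall.isComplete hmaps
    (Metric.mem_closedBall_self hr0.le) (edist_ne_top _ _)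
  rw [mem_closedBall_iff_norm] at hσ
  have hσ' : stressEq (u σ) σ σ := by
    have := hT σ
    rwa [hfix] at this
  refine ⟨(u σ, σ), ⟨hballP σ hσ, (step_iff _ _).2 ⟨hu σ, hσ'⟩⟩, ?_⟩
  rintro ⟨u', σ'⟩ ⟨hP', h'⟩
  obtain ⟨hv', hs'⟩ := (step_iff _ _).1 h'
  have hσR := norm_le_R σ hσ
  have hσR' := apriori u' σ' hP' hv' hs'
  -- Two fixed points are compared. The competitor need not be near `σ₀`; its bound by `R` is all
  -- that the contraction estimate asks of it.
  have hz := stress_contr _ _ _ _ _ _ (hu σ) hv' (u_le σ hσR) hσR' hσ' hs'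
  have hσeq : σ = σ' := by
    have : ‖σ - σ'‖ ≤ 0 := by linarith
    exact sub_eq_zero.1 (norm_le_zero_iff.1 this)
  subst hσeq
  have hu' := vel_bound _ _ _ le_rfl (vel_sub _ _ _ _ hv' (hu σ))
  rw [sub_self, norm_zero, mul_zero, zero_mul, add_zero, norm_le_zero_iff, sub_eq_zero] at hu'
  exact Prod.ext hu' rfl

end AbstractStep

/-! ### Gluing Lipschitz estimates -/

/-- A continuous map that is `L`-Lipschitz on each member of a finite closed cover is
`L`-Lipschitz. -/
theorem norm_sub_le_of_finite_closed_cover {ι E F : Type*} [Finite ι] [NormedAddCommGroup E]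
    [NormedSpace ℝ E] [NormedAddCommGroup F] {f : E → F} (hf : Continuous f) (A : ι → Set E)
    (hA : ∀ i, IsClosed (A i)) (hcov : ∀ x, ∃ i, x ∈ A i) {L : ℝ}
    (hlip : ∀ i, ∀ x ∈ A i, ∀ y ∈ A i, ‖f x - f y‖ ≤ L * ‖x - y‖) (x y : E) :
    ‖f y - f x‖ ≤ L * ‖y - x‖ := by
  set γ : ℝ → E := fun t => x + t • (y - x) with hγ
  have hγc : Continuous γ := by fun_prop
  set M : ℝ := L * ‖y - x‖ with hM
  -- The mean value inequality on the segment from `x` to `y` needs a bounding slope strictly above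
  -- `M`, hence `M + δ`.
  refine le_of_forall_pos_le_add fun δ hδ => ?_
  have key := image_norm_le_of_liminf_right_slope_norm_lt_deriv_boundary
    (f := fun t => f (γ t) - f x) (f' := fun _ => M) (a := 0) (b := 1)
    (B := fun t => (M + δ) * t) (B' := fun _ => M + δ)
    ((hf.comp hγc).sub continuous_const).continuousOn ?_ (by simp [hγ])
    (by fun_prop) (fun t _ => by simpa using ((hasDerivAt_id t).const_mul (M + δ)).hasDerivWithinAt)
    (fun _ _ _ => by linarith) (right_mem_Icc.2 zero_le_one)
  · simpa [hγ] using key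
  intro t _ r hr
  -- By pigeonhole one member of the cover contains points of the segment arbitrarily close to `γ t`
  -- on its right, and by closedness also `γ t`. The estimate on that member bounds infinitely many
  -- right slopes, which suffices for the liminf form of the mean value inequality.
  obtain ⟨i, hi⟩ : ∃ i, ∃ᶠ z in 𝓝[>] t, γ z ∈ A i := by
    by_contra h
    simp only [not_exists, not_frequently] at h
    obtain ⟨z, hz⟩ := (eventually_all.2 h).exists
    obtain ⟨i, hi⟩ := hcov (γ z)
    exact hz i hi
  have hti : γ t ∈ A i := (hA i).mem_of_frequently_of_tendsto hi
    (hγc.continuousAt.tendsto.mono_left nhdsWithin_le_nhds)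
  refine (hi.and_eventually self_mem_nhdsWithin).mono fun z ⟨hz, htz⟩ => lt_of_le_of_lt ?_ hr
  have htz' : 0 < z - t := sub_pos.2 htz
  rw [slope_def_field, div_le_iff₀ htz']
  have h1 := hlip i _ hz _ hti
  have h2 : γ z - γ t = (z - t) • (y - x) := by
    simp only [hγ, sub_smul]
    abel
  rw [h2, norm_smul, Real.norm_of_nonneg htz'.le] at h1
  have h3 := norm_sub_norm_le (f (γ z) - f x) (f (γ t) - f x)
  rw [sub_sub_sub_cancel_right] at h3
  simp only [Function.comp]
  calc _ ≤ _ := h3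
    _ ≤ _ := h1
    _ = M * (z - t) := by rw [hM]; ring

/-! ### Geometry of the mesh and regularity of the velocities -/

namespace Mesh

variable {d : ℕ} (M : Mesh d)

/-- The closed element with vertex set `s`. -/
abbrev closedCell (s : Finset (Space d)) : Set (Space d) := convexHull ℝ (s : Set (Space d))

/-- The open element with vertex set `s`. -/
abbrev openCell (s : Finset (Space d)) : Set (Space d) :=
  interior (convexHull ℝ (s : Set (Space d)))

theorem isCompact_closedCell (s : Finset (Space d)) : IsCompact (closedCell s) :=
  s.finite_toSet.isCompact_convexHull ℝ

theorem openCell_nonempty {s : Finset (Space d)} (hs : s ∈ M.cells) : (openCell s).Nonempty := by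
  rw [interior_convexHull_nonempty_iff_affineSpan_eq_top]
  have h := (M.indep s hs).affineSpan_eq_top_iff_card_eq_finrank_add_one.2
    (by simp [M.card_eq s hs])
  simpa using h

theorem closure_openCell {s : Finset (Space d)} (hs : s ∈ M.cells) :
    closure (openCell s) = closedCell s := by
  rw [(convex_convexHull ℝ _).closure_interior_eq_closure_of_nonempty_interior
    (M.openCell_nonempty hs), (isCompact_closedCell s).isClosed.closure_eq]

theorem openCell_subset_domain {s : Finset (Space d)} (hs : s ∈ M.cells) :
    openCell s ⊆ M.domain :=
  interior_mono (subset_biUnion_of_mem (u := fun s : Finset (Space d) => closedCell s) hs)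

theorem domain_subset : M.domain ⊆ ⋃ s ∈ M.cells, closedCell s := interior_subset

theorem isOpen_domain : IsOpen M.domain := isOpen_interior

theorem isCompact_iUnion_closedCell : IsCompact (⋃ s ∈ M.cells, closedCell s) :=
  M.cells.isCompact_biUnion fun s _ => isCompact_closedCell s

theorem isBounded_domain : Bornology.IsBounded M.domain :=
  M.isCompact_iUnion_closedCell.isBounded.subset M.domain_subset

/-- If two open elements met, conformity would give the hull of the common vertices an interior
point. The common vertices would then span the space, so there would be `d + 1` of them and the
elements would coincide. -/
theorem disjoint_openCell {s t : Finset (Space d)} (hs : s ∈ M.cells) (ht : t ∈ M.cells)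
    (hst : s ≠ t) : Disjoint (openCell s) (openCell t) := by
  classical
  rw [Set.disjoint_iff_inter_eq_empty, ← Set.not_nonempty_iff_eq_empty]
  intro hne
  have hsub : openCell s ∩ openCell t ⊆ openCell (s ∩ t) := by
    rw [← interior_inter]
    refine interior_mono ?_
    simpa [closedCell] using M.conforming s hs t ht
  have h := interior_convexHull_nonempty_iff_affineSpan_eq_top.1 (hne.mono hsub)
  have hcard : (s ∩ t).card < d + 1 := by
    refine lt_of_le_of_ne ((Finset.card_le_card Finset.inter_subset_left).trans_eq
      (M.card_eq s hs)) fun hc => hst ?_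
    have h1 : s ∩ t = s := Finset.eq_of_subset_of_card_le Finset.inter_subset_left
      (by rw [hc, M.card_eq s hs])
    have h2 : s ∩ t = t := Finset.eq_of_subset_of_card_le Finset.inter_subset_right
      (by rw [hc, M.card_eq t ht])
    exact h1.symm.trans h2
  have hind : AffineIndependent ℝ ((↑) : (s ∩ t : Finset (Space d)) → Space d) :=
    (M.indep s hs).mono (by simp)
  have h3 := hind.affineSpan_eq_top_iff_card_eq_finrank_add_one.1 (by
    rw [← h, Subtype.range_coe_subtype]
    rfl)
  simp at h3
  omega

/-- A field that is quadratic on a set agrees there with a smooth field. -/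
theorem IsQuadraticOn.exists_contDiff {v : Space d → Space d} {A : Set (Space d)}
    (h : IsQuadraticOn v A) : ∃ p : Space d → Space d, ContDiff ℝ 1 p ∧ EqOn v p A := by
  choose P _ hP using h
  refine ⟨fun x => WithLp.toLp 2 fun i => MvPolynomial.eval (fun j => x j) (P i), ?_, fun x hx => ?_⟩
  · rw [contDiff_euclidean]
    intro i
    have h := (AnalyticOnNhd.eval_linearMap
      (WithLp.linearEquiv 2 ℝ (Fin d → ℝ)).toLinearMap (P i)).contDiff (n := 1)
    exact h
  · ext i
    exact hP i x hx

variable {M}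

theorem contDiff_of_mem_velocitySpace {u : Space d → Space d} (hu : u ∈ M.velocitySpace)
    {s : Finset (Space d)} (hs : s ∈ M.cells) :
    ∃ p : Space d → Space d, ContDiff ℝ 1 p ∧ EqOn u p (closedCell s) :=
  (hu.2.2 s hs).exists_contDiff

/-- The closed elements are completed to a closed cover of the whole space by the zero set of `u`,
which contains the complement of the domain. -/
theorem norm_sub_le_of_mem_velocitySpace {u : Space d → Space d} (hu : u ∈ M.velocitySpace)
    {L : ℝ} (hL : 0 ≤ L)
    (h : ∀ s ∈ M.cells, ∀ x ∈ closedCell s, ∀ y ∈ closedCell s, ‖u x - u y‖ ≤ L * ‖x - y‖)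
    (x y : Space d) : ‖u y - u x‖ ≤ L * ‖y - x‖ := by
  refine norm_sub_le_of_finite_closed_cover (ι := Option M.cells) hu.1
    (fun o => o.elim {x | u x = 0} fun s => closedCell s.1) ?_ ?_ ?_ x y
  · rintro (_ | s)
    · exact isClosed_eq hu.1 continuous_const
    · exact (isCompact_closedCell _).isClosed
  · intro x
    by_cases hx : x ∈ M.domain
    · obtain ⟨s, hs, hxs⟩ := mem_iUnion₂.1 (M.domain_subset hx)
      exact ⟨some ⟨s, hs⟩, hxs⟩
    · exact ⟨none, hu.2.1 x hx⟩
  · rintro (_ | s)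
    · intro x (hx : u x = 0) y (hy : u y = 0)
      rw [hx, hy, sub_zero, norm_zero]
      positivity
    · exact h s.1 s.2

/-- This global bound makes the characteristics well defined although the gradient of `u` jumps
between elements. -/
theorem exists_lipschitzWith_of_mem_velocitySpace {u : Space d → Space d}
    (hu : u ∈ M.velocitySpace) : ∃ K, LipschitzWith K u := by
  have h : ∀ s : M.cells, ∃ K : NNReal, LipschitzOnWith K u (closedCell s.1) := fun s => by
    obtain ⟨p, hp, hup⟩ := contDiff_of_mem_velocitySpace hu s.2
    obtain ⟨K, hK⟩ := hp.contDiffOn.locallyLipschitzOn (convex_convexHull ℝ _)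
      |>.exists_lipschitzOnWith_of_compact (isCompact_closedCell s.1)
    exact ⟨K, fun x hx y hy => by rw [hup hx, hup hy]; exact hK hx hy⟩
  choose K hK using h
  refine ⟨∑ s, K s, LipschitzWith.of_dist_le_mul fun x y => ?_⟩
  rw [dist_eq_norm, dist_eq_norm]
  refine norm_sub_le_of_mem_velocitySpace hu (by positivity) (fun s hs x hx y hy => ?_) y x
  rw [← dist_eq_norm, ← dist_eq_norm]
  refine ((hK ⟨s, hs⟩).dist_le_mul x hx y hy).trans ?_
  gcongr
  exact Finset.single_le_sum (f := K) (fun _ _ => zero_le) (Finset.mem_univ _)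

theorem exists_norm_le_of_mem_velocitySpace {u : Space d → Space d}
    (hu : u ∈ M.velocitySpace) : ∃ C : NNReal, ∀ x, ‖u x‖ ≤ C := by
  obtain ⟨C, hC⟩ := (M.isCompact_iUnion_closedCell).exists_bound_of_continuousOn hu.1.continuousOn
  refine ⟨C.toNNReal, fun x => ?_⟩
  by_cases hx : x ∈ M.domain
  · exact (hC x (M.domain_subset hx)).trans (Real.le_coe_toNNReal C)
  · rw [hu.2.1 x hx, norm_zero]
    positivity

theorem differentiableAt_of_mem_openCell {u : Space d → Space d} (hu : u ∈ M.velocitySpace)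
    {s : Finset (Space d)} (hs : s ∈ M.cells) {x : Space d} (hx : x ∈ openCell s) :
    DifferentiableAt ℝ u x := by
  obtain ⟨p, hp, hup⟩ := contDiff_of_mem_velocitySpace hu hs
  refine (hp.differentiable one_ne_zero x).congr_of_eventuallyEq ?_
  filter_upwards [mem_interior_iff_mem_nhds.1 hx] with y hy using hup hy

theorem exists_continuous_fderiv_eqOn {u : Space d → Space d} (hu : u ∈ M.velocitySpace)
    {s : Finset (Space d)} (hs : s ∈ M.cells) :
    ∃ p : Space d → Space d →L[ℝ] Space d, Continuous p ∧ EqOn (fderiv ℝ u) p (openCell s) := by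
  obtain ⟨p, hp, hup⟩ := contDiff_of_mem_velocitySpace hu hs
  refine ⟨fderiv ℝ p, hp.continuous_fderiv one_ne_zero, fun x hx => Filter.EventuallyEq.fderiv_eq ?_⟩
  filter_upwards [mem_interior_iff_mem_nhds.1 hx] with y hy using hup hy

/-- A velocity field whose gradient vanishes in the elements is zero. -/
theorem eq_zero_of_fderiv_eq_zero (hd : 0 < d) {u : Space d → Space d} (hu : u ∈ M.velocitySpace)
    (h : ∀ s ∈ M.cells, ∀ x ∈ openCell s, fderiv ℝ u x = 0) : u = 0 := by
  -- Being constant is the case `L = 0` of the gluing lemma, so no connectedness of the mesh is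
  -- needed. The constant is read off at a point outside of the bounded domain.
  have h0 : ∀ s ∈ M.cells, ∀ x ∈ closedCell s, ∀ y ∈ closedCell s, ‖u x - u y‖ ≤ 0 * ‖x - y‖ := by
    intro s hs x hx y hy
    obtain ⟨z, hz⟩ := M.openCell_nonempty hs
    have hc : EqOn u (fun _ => u z) (openCell s) := fun x hx =>
      isOpen_interior.is_const_of_fderiv_eq_zero
        (convex_convexHull ℝ _).interior.isPreconnected
        (fun x hx => (differentiableAt_of_mem_openCell hu hs hx).differentiableWithinAt)
        (h s hs) hx hz
    have hc' := hc.closure hu.1 continuous_const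
    rw [closure_openCell M hs] at hc'
    rw [hc' hx, hc' hy]
    simp
  obtain ⟨x₀, hx₀⟩ : ∃ x, x ∉ M.domain := by
    by_contra! hall
    have hb := M.isBounded_domain
    rw [eq_univ_of_forall hall] at hb
    have : Nontrivial (Space d) := by
      have : Nonempty (Fin d) := ⟨⟨0, hd⟩⟩
      infer_instance
    exact NormedSpace.unbounded_univ ℝ (Space d) hb
  funext x
  have h1 := norm_sub_le_of_mem_velocitySpace hu le_rfl h0 x₀ x
  rw [hu.2.1 x₀ hx₀, zero_mul, sub_zero] at h1
  exact norm_le_zero_iff.1 h1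

/-- The polynomial fields of degree at most `2`, restricted to a set. -/
def restrictedQuadratic (A : Set (Space d)) : Submodule ℝ (A → ℝ) :=
  (MvPolynomial.restrictTotalDegree (Fin d) ℝ 2).map
    (LinearMap.pi fun x : A => (MvPolynomial.aeval (fun j => x.1 j)).toLinearMap)

instance (A : Set (Space d)) : FiniteDimensional ℝ (restrictedQuadratic A) := by
  unfold restrictedQuadratic
  infer_instance

instance : FiniteDimensional ℝ M.velocitySpace := by
  let f : M.velocitySpace →ₗ[ℝ]
      ((s : M.cells) → Fin d → restrictedQuadratic (closedCell s.1)) :=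
    { toFun := fun v s i => ⟨fun x => v.1 x.1 i, by
        obtain ⟨P, hP, hPe⟩ := v.2.2.2 s.1 s.2 i
        refine ⟨P, (MvPolynomial.mem_restrictTotalDegree _ _ _).2 hP, ?_⟩
        funext x
        simp [hPe x.1 x.2, MvPolynomial.aeval_eq_eval]⟩
      map_add' := fun v w => rfl
      map_smul' := fun c v => rfl }
  refine FiniteDimensional.of_injective f fun v w h => Subtype.ext (funext fun x => ?_)
  by_cases hx : x ∈ M.domain
  · obtain ⟨s, hs, hxs⟩ := mem_iUnion₂.1 (M.domain_subset hx)
    ext i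
    have h1 := congrFun (congrFun h ⟨s, hs⟩) i
    exact congrFun (congrArg Subtype.val h1) ⟨x, hxs⟩
  · rw [v.2.2.1 x hx, w.2.2.1 x hx]

end Mesh

/-! ### The double contraction of matrices -/

section Ddot

variable {d : ℕ}

theorem ddot_add_left (A B C : Matrix (Fin d) (Fin d) ℝ) : ddot (A + B) C = ddot A C + ddot B C := by
  simp [ddot, add_mul]

theorem ddot_add_right (A B C : Matrix (Fin d) (Fin d) ℝ) :
    ddot A (B + C) = ddot A B + ddot A C := by
  simp [ddot, mul_add]

theorem ddot_sub_left (A B C : Matrix (Fin d) (Fin d) ℝ) : ddot (A - B) C = ddot A C - ddot B C := by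
  simp [ddot, sub_mul]

theorem ddot_smul_left (c : ℝ) (A B : Matrix (Fin d) (Fin d) ℝ) :
    ddot (c • A) B = c * ddot A B := by
  simp [ddot]

theorem ddot_smul_right (c : ℝ) (A B : Matrix (Fin d) (Fin d) ℝ) :
    ddot A (c • B) = c * ddot A B := by
  simp [ddot]

theorem ddot_comm (A B : Matrix (Fin d) (Fin d) ℝ) : ddot A B = ddot B A := by
  rw [ddot, ddot, ← Matrix.trace_transpose, Matrix.transpose_mul, Matrix.transpose_transpose]

theorem ddot_self (A : Matrix (Fin d) (Fin d) ℝ) : ddot A A = ∑ i, ∑ j, A i j ^ 2 := by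
  simp [ddot, Matrix.trace, Matrix.mul_apply, sq]

theorem ddot_self_nonneg (A : Matrix (Fin d) (Fin d) ℝ) : 0 ≤ ddot A A := by
  rw [ddot_self]
  positivity

theorem eq_zero_of_ddot_self {A : Matrix (Fin d) (Fin d) ℝ} (h : ddot A A = 0) : A = 0 := by
  rw [ddot_self, Finset.sum_eq_zero_iff_of_nonneg fun _ _ => by positivity] at h
  ext i j
  have h1 := h i (Finset.mem_univ _)
  rw [Finset.sum_eq_zero_iff_of_nonneg fun _ _ => by positivity] at h1
  simpa using h1 j (Finset.mem_univ _)

/-- The algebraic source of the energy estimate: in the trace of the stress equation the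
upper-convected term is twice the work of the stress. -/
theorem ddot_upperConvected_one (G A : Matrix (Fin d) (Fin d) ℝ) (hA : A.IsSymm) :
    ddot (G * A + A * Gᵀ) 1 = 2 * ddot A G := by
  have h : (G * A).trace = (A * Gᵀ).trace := by
    rw [← Matrix.trace_transpose, Matrix.transpose_mul, hA.eq]
  simp only [ddot, Matrix.transpose_one, mul_one, Matrix.trace_add, h]
  ring

theorem continuous_ddot : Continuous fun p : Matrix (Fin d) (Fin d) ℝ × Matrix (Fin d) (Fin d) ℝ =>
    ddot p.1 p.2 := by
  unfold ddot
  fun_prop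

end Ddot

/-! ### Piecewise continuous fields and their integrals -/

namespace Mesh

variable {d : ℕ} (M : Mesh d)

/-- Boundaries of convex sets are null sets, so integrals see a field only inside the elements,
where it is given by polynomials. -/
theorem ae_mem_openCell : ∀ᵐ x ∂(volume.restrict M.domain), ∃ s ∈ M.cells, x ∈ openCell s := by
  have h : ∀ᵐ x : Space d, ∀ s ∈ M.cells, x ∉ frontier (closedCell s) := by
    refine (M.cells.eventually_all).2 fun s _ => ?_
    exact measure_eq_zero_iff_ae_notMem.1 ((convex_convexHull ℝ _).addHaar_frontier volume)
  filter_upwards [ae_restrict_of_ae h, ae_restrict_mem M.isOpen_domain.measurableSet] with x hx hxd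
  obtain ⟨s, hs, hxs⟩ := mem_iUnion₂.1 (M.domain_subset hxd)
  refine ⟨s, hs, ?_⟩
  by_contra hc
  exact hx s hs ⟨subset_closure hxs, hc⟩

theorem setIntegral_congr_openCell {f g : Space d → ℝ}
    (h : ∀ s ∈ M.cells, EqOn f g (openCell s)) :
    ∫ x in M.domain, f x = ∫ x in M.domain, g x := by
  refine integral_congr_ae ?_
  filter_upwards [M.ae_mem_openCell] with x ⟨s, hs, hx⟩ using h s hs hx

/-- A field that agrees on each open element with a continuous field on the whole space. -/
def PiecewiseContinuous {E : Type*} [TopologicalSpace E] (f : Space d → E) : Prop :=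
  ∀ s ∈ M.cells, ∃ g : Space d → E, Continuous g ∧ EqOn f g (openCell s)

variable {M}

theorem PiecewiseContinuous.of_continuous {E : Type*} [TopologicalSpace E] {f : Space d → E}
    (hf : Continuous f) : M.PiecewiseContinuous f := fun _ _ => ⟨f, hf, fun _ _ => rfl⟩

theorem PiecewiseContinuous.comp {E F : Type*} [TopologicalSpace E] [TopologicalSpace F]
    {f : Space d → E} (hf : M.PiecewiseContinuous f) {k : E → F} (hk : Continuous k) :
    M.PiecewiseContinuous fun x => k (f x) := fun s hs => by
  obtain ⟨g, hg, hfg⟩ := hf s hs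
  exact ⟨fun x => k (g x), hk.comp hg, fun x hx => congrArg k (hfg hx)⟩

theorem PiecewiseContinuous.prodMk {E F : Type*} [TopologicalSpace E] [TopologicalSpace F]
    {f : Space d → E} {f' : Space d → F} (hf : M.PiecewiseContinuous f)
    (hf' : M.PiecewiseContinuous f') : M.PiecewiseContinuous fun x => (f x, f' x) := fun s hs => by
  obtain ⟨g, hg, hfg⟩ := hf s hs
  obtain ⟨g', hg', hfg'⟩ := hf' s hs
  exact ⟨fun x => (g x, g' x), hg.prodMk hg', fun x hx => Prod.ext (hfg hx) (hfg' hx)⟩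

theorem PiecewiseContinuous.integrableOn {f : Space d → ℝ} (hf : M.PiecewiseContinuous f) :
    IntegrableOn f M.domain := by
  have h1 : IntegrableOn f (⋃ s ∈ M.cells, openCell s) := by
    refine integrableOn_finset_iUnion.2 fun s hs => ?_
    obtain ⟨g, hg, hfg⟩ := hf s hs
    exact ((hg.continuousOn.integrableOn_compact (isCompact_closedCell s)).mono_set
      interior_subset).congr_fun hfg.symm isOpen_interior.measurableSet
  refine h1.mono_set_ae ?_
  filter_upwards [(ae_restrict_iff' M.isOpen_domain.measurableSet).1 M.ae_mem_openCell] with x hx hxd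
  exact mem_iUnion₂.2 (by simpa using hx hxd)

/-- A nonnegative piecewise continuous function with zero integral vanishes in the elements. -/
theorem PiecewiseContinuous.eq_zero_of_integral {f : Space d → ℝ} (hf : M.PiecewiseContinuous f)
    (h0 : ∀ x, 0 ≤ f x) (hint : ∫ x in M.domain, f x = 0) :
    ∀ s ∈ M.cells, ∀ x ∈ openCell s, f x = 0 := by
  intro s hs x hx
  obtain ⟨g, hg, hfg⟩ := hf s hs
  have h1 := (setIntegral_eq_zero_iff_of_nonneg_ae (ae_of_all _ h0) hf.integrableOn).1 hint
  have h2 : f =ᵐ[volume.restrict (openCell s)] 0 :=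
    ae_restrict_of_ae_restrict_of_subset (M.openCell_subset_domain hs) h1
  have h3 : g =ᵐ[volume.restrict (openCell s)] 0 := by
    filter_upwards [h2, ae_restrict_mem isOpen_interior.measurableSet] with y hy hys
    rw [← hfg hys, hy]
  have h4 := Measure.eqOn_open_of_ae_eq h3 isOpen_interior hg.continuousOn continuousOn_const
  rw [hfg hx]
  exact h4 hx

theorem stressField_of_mem (σ : M.stressSpace) (s : M.cells) {x : Space d}
    (hx : x ∈ openCell s.1) : M.stressField σ x = σ.1 s := by
  unfold stressField
  rw [Finset.sum_eq_single s, indicator_of_mem hx]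
  · intro t _ hts
    refine indicator_of_notMem (fun hxt => ?_) _
    exact disjoint_left.1 (M.disjoint_openCell t.2 s.2 fun h => hts (Subtype.ext h)) hxt hx
  · simp

theorem pressureField_of_mem (p : M.PressureSpace) (s : M.cells) {x : Space d}
    (hx : x ∈ openCell s.1) : M.pressureField p x = p s x := by
  unfold pressureField
  rw [Finset.sum_eq_single s, indicator_of_mem hx]
  · intro t _ hts
    refine indicator_of_notMem (fun hxt => ?_) _
    exact disjoint_left.1 (M.disjoint_openCell t.2 s.2 fun h => hts (Subtype.ext h)) hxt hx
  · simp

theorem stressField_add (σ τ : M.stressSpace) (x : Space d) :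
    M.stressField (σ + τ) x = M.stressField σ x + M.stressField τ x := by
  simp only [stressField, ← Finset.sum_add_distrib]
  refine Finset.sum_congr rfl fun s _ => ?_
  by_cases hx : x ∈ openCell s.1 <;> simp [hx]

theorem stressField_smul (c : ℝ) (σ : M.stressSpace) (x : Space d) :
    M.stressField (c • σ) x = c • M.stressField σ x := by
  simp only [stressField, Finset.smul_sum]
  refine Finset.sum_congr rfl fun s _ => ?_
  by_cases hx : x ∈ openCell s.1 <;> simp [hx]

theorem stressField_isSymm (σ : M.stressSpace) (x : Space d) : (M.stressField σ x).IsSymm := by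
  unfold stressField Matrix.IsSymm
  rw [Matrix.transpose_sum]
  refine Finset.sum_congr rfl fun s _ => ?_
  by_cases hx : x ∈ openCell s.1
  · simpa [hx] using (σ.2 s).eq
  · simp [hx]

theorem piecewiseContinuous_stressField (σ : M.stressSpace) :
    M.PiecewiseContinuous (M.stressField σ) := fun s hs =>
  ⟨fun _ => σ.1 ⟨s, hs⟩, continuous_const, fun _ hx => stressField_of_mem σ ⟨s, hs⟩ hx⟩

theorem piecewiseContinuous_pressureField (p : M.PressureSpace) :
    M.PiecewiseContinuous (M.pressureField p) := fun s hs =>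
  ⟨p ⟨s, hs⟩, (p ⟨s, hs⟩).continuous_of_finiteDimensional,
    fun _ hx => pressureField_of_mem p ⟨s, hs⟩ hx⟩

theorem piecewiseContinuous_velocity (u : M.velocitySpace) : M.PiecewiseContinuous u.1 :=
  .of_continuous u.2.1

theorem piecewiseContinuous_fderiv (u : M.velocitySpace) :
    M.PiecewiseContinuous (fderiv ℝ u.1) := fun _ hs => exists_continuous_fderiv_eqOn u.2 hs

theorem piecewiseContinuous_grad (u : M.velocitySpace) : M.PiecewiseContinuous (grad u.1) :=
  (piecewiseContinuous_fderiv u).comp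
    (k := fun A : Space d →L[ℝ] Space d => Matrix.of fun i j => A (EuclideanSpace.single j 1) i)
    (by
      refine continuous_matrix fun i j => ?_
      simp only [Matrix.of_apply]
      fun_prop)

theorem piecewiseContinuous_divergence (u : M.velocitySpace) :
    M.PiecewiseContinuous (divergence u.1) :=
  (piecewiseContinuous_grad u).comp (k := Matrix.trace) (by fun_prop)

theorem piecewiseContinuous_convect (u₀ u : M.velocitySpace) :
    M.PiecewiseContinuous (convect u₀.1 u.1) :=
  ((piecewiseContinuous_fderiv u).prodMk (piecewiseContinuous_velocity u₀)).comp
    (k := fun p : (Space d →L[ℝ] Space d) × Space d => p.1 p.2) (by fun_prop)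

theorem PiecewiseContinuous.ddot {f g : Space d → Matrix (Fin d) (Fin d) ℝ}
    (hf : M.PiecewiseContinuous f) (hg : M.PiecewiseContinuous g) :
    M.PiecewiseContinuous fun x => OldroydB.ddot (f x) (g x) :=
  (hf.prodMk hg).comp continuous_ddot

theorem PiecewiseContinuous.inner {f g : Space d → Space d}
    (hf : M.PiecewiseContinuous f) (hg : M.PiecewiseContinuous g) :
    M.PiecewiseContinuous fun x => Inner.inner ℝ (f x) (g x) :=
  (hf.prodMk hg).comp (k := fun p : Space d × Space d => Inner.inner ℝ p.1 p.2) (by fun_prop)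

theorem PiecewiseContinuous.mul {f g : Space d → ℝ}
    (hf : M.PiecewiseContinuous f) (hg : M.PiecewiseContinuous g) :
    M.PiecewiseContinuous fun x => f x * g x :=
  (hf.prodMk hg).comp (k := fun p : ℝ × ℝ => p.1 * p.2) (by fun_prop)

theorem piecewiseContinuous_upperConvected (u : M.velocitySpace) (σ : M.stressSpace) :
    M.PiecewiseContinuous fun x =>
      grad u.1 x * M.stressField σ x + M.stressField σ x * (grad u.1 x)ᵀ :=
  ((piecewiseContinuous_grad u).prodMk (piecewiseContinuous_stressField σ)).comp
    (k := fun p : Matrix (Fin d) (Fin d) ℝ × Matrix (Fin d) (Fin d) ℝ => p.1 * p.2 + p.2 * p.1ᵀ)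
    (by fun_prop)

section CellLinear

variable {s : Finset (Space d)} {x : Space d}

/-- Linearity of the gradient is available only inside the elements: on their boundaries a velocity
may fail to be differentiable, and `fderiv` then takes its default value. -/
theorem fderiv_add_of_mem (hs : s ∈ M.cells) (hx : x ∈ openCell s) (u v : M.velocitySpace) :
    fderiv ℝ (u + v).1 x = fderiv ℝ u.1 x + fderiv ℝ v.1 x :=
  fderiv_add (differentiableAt_of_mem_openCell u.2 hs hx)
    (differentiableAt_of_mem_openCell v.2 hs hx)

theorem fderiv_smul_of_mem (hs : s ∈ M.cells) (hx : x ∈ openCell s) (c : ℝ) (u : M.velocitySpace) :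
    fderiv ℝ (c • u).1 x = c • fderiv ℝ u.1 x :=
  fderiv_const_smul (differentiableAt_of_mem_openCell u.2 hs hx) c

theorem grad_add_of_mem (hs : s ∈ M.cells) (hx : x ∈ openCell s) (u v : M.velocitySpace) :
    grad (u + v).1 x = grad u.1 x + grad v.1 x := by
  ext i j
  simp only [grad, fderiv_add_of_mem hs hx, Matrix.of_apply, Matrix.add_apply]
  rfl

theorem grad_smul_of_mem (hs : s ∈ M.cells) (hx : x ∈ openCell s) (c : ℝ) (u : M.velocitySpace) :
    grad (c • u).1 x = c • grad u.1 x := by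
  ext i j
  simp only [grad, fderiv_smul_of_mem hs hx, Matrix.of_apply, Matrix.smul_apply]
  rfl

theorem divergence_add_of_mem (hs : s ∈ M.cells) (hx : x ∈ openCell s) (u v : M.velocitySpace) :
    divergence (u + v).1 x = divergence u.1 x + divergence v.1 x := by
  simp only [divergence, grad_add_of_mem hs hx, Matrix.trace_add]

theorem divergence_smul_of_mem (hs : s ∈ M.cells) (hx : x ∈ openCell s) (c : ℝ)
    (u : M.velocitySpace) : divergence (c • u).1 x = c * divergence u.1 x := by
  simp only [divergence, grad_smul_of_mem hs hx, Matrix.trace_smul, smul_eq_mul]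

end CellLinear

section IntegralForms

variable {V W Z : Type*} [AddCommGroup V] [Module ℝ V] [AddCommGroup W] [Module ℝ W]
  [AddCommGroup Z] [Module ℝ Z]

/-- The integral of a density that depends linearly on `v` at the points of the open elements. -/
theorem isLinearMap_integral {D : V → Space d → ℝ} (hD : ∀ v, IntegrableOn (D v) M.domain)
    (h : ∀ s ∈ M.cells, ∀ x ∈ openCell s, IsLinearMap ℝ fun v => D v x) :
    IsLinearMap ℝ fun v => ∫ x in M.domain, D v x where
  map_add v w := by
    rw [← integral_add (hD v) (hD w)]
    exact M.setIntegral_congr_openCell fun s hs x hx => (h s hs x hx).map_add v w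
  map_smul c v := by
    rw [smul_eq_mul, ← integral_const_mul]
    exact M.setIntegral_congr_openCell fun s hs x hx => (h s hs x hx).map_smul c v

theorem exists_bilinear_of_isLinearMap {f : V → W → ℝ} (h₁ : ∀ w, IsLinearMap ℝ fun v => f v w)
    (h₂ : ∀ v, IsLinearMap ℝ fun w => f v w) : ∃ B : V →ₗ[ℝ] W →ₗ[ℝ] ℝ, ∀ v w, B v w = f v w :=
  ⟨LinearMap.mk₂ ℝ f (fun v v' w => (h₁ w).map_add v v') (fun c v w => (h₁ w).map_smul c v)
    (fun v w w' => (h₂ v).map_add w w') (fun c v w => (h₂ v).map_smul c w), fun _ _ => rfl⟩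

theorem exists_trilinear_of_isLinearMap {f : V → W → Z → ℝ}
    (h₁ : ∀ w z, IsLinearMap ℝ fun v => f v w z) (h₂ : ∀ v z, IsLinearMap ℝ fun w => f v w z)
    (h₃ : ∀ v w, IsLinearMap ℝ fun z => f v w z) :
    ∃ B : V →ₗ[ℝ] W →ₗ[ℝ] Z →ₗ[ℝ] ℝ, ∀ v w z, B v w z = f v w z :=
  ⟨LinearMap.mk₂ ℝ (fun v w => (h₃ v w).mk')
    (fun v v' w => LinearMap.ext fun z => (h₁ w z).map_add v v')
    (fun c v w => LinearMap.ext fun z => (h₁ w z).map_smul c v)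
    (fun v w w' => LinearMap.ext fun z => (h₂ v z).map_add w w')
    (fun c v w => LinearMap.ext fun z => (h₂ v z).map_smul c w), fun _ _ _ => rfl⟩

end IntegralForms

end Mesh

/-! ### The forms of the scheme and the recovery of the pressure -/

namespace Mesh

variable {d : ℕ} {M : Mesh d}

theorem exists_massForm (M : Mesh d) : ∃ m : M.velocitySpace →ₗ[ℝ] M.velocitySpace →ₗ[ℝ] ℝ,
    ∀ v w, m v w = ∫ x in M.domain, inner ℝ (v.1 x) (w.1 x) := by
  have hint : ∀ v w : M.velocitySpace, IntegrableOn (fun x => inner ℝ (v.1 x) (w.1 x)) M.domain :=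
    fun v w => ((piecewiseContinuous_velocity v).inner (piecewiseContinuous_velocity w)).integrableOn
  refine exists_bilinear_of_isLinearMap (fun w => isLinearMap_integral (fun v => hint v w) ?_)
    (fun v => isLinearMap_integral (fun w => hint v w) ?_)
  · exact fun s hs x hx => ⟨fun v v' => inner_add_left _ _ _, fun c v => real_inner_smul_left _ _ _⟩
  · exact fun s hs x hx => ⟨fun v v' => inner_add_right _ _ _, fun c v => real_inner_smul_right _ _ _⟩

theorem massForm_pos (v : M.velocitySpace) (hv : v ≠ 0) :
    0 < ∫ x in M.domain, inner ℝ (v.1 x) (v.1 x) := by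
  have h0 : ∀ x, 0 ≤ (inner ℝ (v.1 x) (v.1 x) : ℝ) := fun x => real_inner_self_nonneg
  refine lt_of_le_of_ne (integral_nonneg h0) fun h => hv (Subtype.ext (funext fun x => ?_))
  have h1 := (setIntegral_eq_zero_iff_of_nonneg_ae (ae_of_all _ h0)
    ((piecewiseContinuous_velocity v).inner (piecewiseContinuous_velocity v)).integrableOn).1 h.symm
  have hc : Continuous fun x => (inner ℝ (v.1 x) (v.1 x) : ℝ) := v.2.1.inner v.2.1
  have h2 := Measure.eqOn_open_of_ae_eq h1 M.isOpen_domain hc.continuousOn continuousOn_const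
  by_cases hx : x ∈ M.domain
  · exact inner_self_eq_zero.1 (h2 hx)
  · exact v.2.2.1 x hx

theorem exists_dirichletForm (M : Mesh d) : ∃ a : M.velocitySpace →ₗ[ℝ] M.velocitySpace →ₗ[ℝ] ℝ,
    ∀ v w, a v w = ∫ x in M.domain, ddot (grad v.1 x) (grad w.1 x) := by
  have hint : ∀ v w : M.velocitySpace,
      IntegrableOn (fun x => ddot (grad v.1 x) (grad w.1 x)) M.domain :=
    fun v w => ((piecewiseContinuous_grad v).ddot (piecewiseContinuous_grad w)).integrableOn
  refine exists_bilinear_of_isLinearMap (fun w => isLinearMap_integral (fun v => hint v w) ?_)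
    (fun v => isLinearMap_integral (fun w => hint v w) ?_)
  · exact fun s hs x hx => ⟨fun v v' => by rw [grad_add_of_mem hs hx, ddot_add_left],
      fun c v => by rw [grad_smul_of_mem hs hx, ddot_smul_left, smul_eq_mul]⟩
  · exact fun s hs x hx => ⟨fun v v' => by rw [grad_add_of_mem hs hx, ddot_add_right],
      fun c v => by rw [grad_smul_of_mem hs hx, ddot_smul_right, smul_eq_mul]⟩

theorem fderiv_eq_zero_of_grad_eq_zero {u : Space d → Space d} {x : Space d} (h : grad u x = 0) :
    fderiv ℝ u x = 0 := by
  refine ContinuousLinearMap.coe_injective ?_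
  refine (EuclideanSpace.basisFun (Fin d) ℝ).toBasis.ext fun j => ?_
  ext i
  simpa [grad] using congrFun (congrFun h i) j

theorem eq_zero_of_dirichletForm (hd : 0 < d) (v : M.velocitySpace)
    (h : ∫ x in M.domain, ddot (grad v.1 x) (grad v.1 x) = 0) : v = 0 := by
  have h1 := ((piecewiseContinuous_grad v).ddot (piecewiseContinuous_grad v)).eq_zero_of_integral
    (fun x => ddot_self_nonneg _) h
  exact Subtype.ext (eq_zero_of_fderiv_eq_zero hd v.2 fun s hs x hx =>
    fderiv_eq_zero_of_grad_eq_zero (eq_zero_of_ddot_self (h1 s hs x hx)))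

theorem exists_convectForm (u₀ : M.velocitySpace) :
    ∃ c : M.velocitySpace →ₗ[ℝ] M.velocitySpace →ₗ[ℝ] ℝ,
      ∀ v w, c v w = ∫ x in M.domain, inner ℝ (convect u₀.1 v.1 x) (w.1 x) := by
  have hint : ∀ v w : M.velocitySpace,
      IntegrableOn (fun x => inner ℝ (convect u₀.1 v.1 x) (w.1 x)) M.domain :=
    fun v w => ((piecewiseContinuous_convect u₀ v).inner
      (piecewiseContinuous_velocity w)).integrableOn
  refine exists_bilinear_of_isLinearMap (fun w => isLinearMap_integral (fun v => hint v w) ?_)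
    (fun v => isLinearMap_integral (fun w => hint v w) ?_)
  · refine fun s hs x hx => ⟨fun v v' => ?_, fun c v => ?_⟩
    · rw [convect, fderiv_add_of_mem hs hx, add_apply, inner_add_left]
      rfl
    · rw [convect, fderiv_smul_of_mem hs hx, smul_apply, real_inner_smul_left]
      rfl
  · exact fun s hs x hx => ⟨fun v v' => inner_add_right _ _ _, fun c v => real_inner_smul_right _ _ _⟩

theorem exists_couplingForm (M : Mesh d) : ∃ b : M.stressSpace →ₗ[ℝ] M.velocitySpace →ₗ[ℝ] ℝ,
    ∀ σ v, b σ v = ∫ x in M.domain, ddot (M.stressField σ x) (grad v.1 x) := by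
  have hint : ∀ (σ : M.stressSpace) (v : M.velocitySpace),
      IntegrableOn (fun x => ddot (M.stressField σ x) (grad v.1 x)) M.domain :=
    fun σ v => ((piecewiseContinuous_stressField σ).ddot (piecewiseContinuous_grad v)).integrableOn
  refine exists_bilinear_of_isLinearMap (fun w => isLinearMap_integral (fun v => hint v w) ?_)
    (fun v => isLinearMap_integral (fun w => hint v w) ?_)
  · exact fun s hs x hx => ⟨fun v v' => by rw [stressField_add, ddot_add_left],
      fun c v => by rw [stressField_smul, ddot_smul_left, smul_eq_mul]⟩
  · exact fun s hs x hx => ⟨fun v v' => by rw [grad_add_of_mem hs hx, ddot_add_right],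
      fun c v => by rw [grad_smul_of_mem hs hx, ddot_smul_right, smul_eq_mul]⟩

theorem exists_upperConvectedForm (M : Mesh d) :
    ∃ B : M.velocitySpace →ₗ[ℝ] M.stressSpace →ₗ[ℝ] M.stressSpace →ₗ[ℝ] ℝ,
      ∀ u σ φ, B u σ φ = ∫ x in M.domain, ddot (grad u.1 x * M.stressField σ x
        + M.stressField σ x * (grad u.1 x)ᵀ) (M.stressField φ x) := by
  have hint : ∀ (u : M.velocitySpace) (σ φ : M.stressSpace),
      IntegrableOn (fun x => ddot (grad u.1 x * M.stressField σ x
        + M.stressField σ x * (grad u.1 x)ᵀ) (M.stressField φ x)) M.domain :=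
    fun u σ φ => ((piecewiseContinuous_upperConvected u σ).ddot
      (piecewiseContinuous_stressField φ)).integrableOn
  refine exists_trilinear_of_isLinearMap
    (fun σ φ => isLinearMap_integral (fun u => hint u σ φ) ?_)
    (fun u φ => isLinearMap_integral (fun σ => hint u σ φ) ?_)
    (fun u σ => isLinearMap_integral (fun φ => hint u σ φ) ?_)
  · refine fun s hs x hx => ⟨fun v v' => ?_, fun c v => ?_⟩
    · rw [grad_add_of_mem hs hx, ← ddot_add_left, add_mul, Matrix.transpose_add, mul_add]
      congr 1
      abel
    · rw [grad_smul_of_mem hs hx, smul_eq_mul, ← ddot_smul_left]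
      simp
  · refine fun s hs x hx => ⟨fun v v' => ?_, fun c v => ?_⟩
    · rw [stressField_add, ← ddot_add_left, add_mul, mul_add]
      congr 1
      abel
    · rw [stressField_smul, smul_eq_mul, ← ddot_smul_left]
      simp
  · exact fun s hs x hx => ⟨fun v v' => by rw [stressField_add, ddot_add_right],
      fun c v => by rw [stressField_smul, ddot_smul_right, smul_eq_mul]⟩

theorem exists_stressForm (M : Mesh d) : ∃ g : M.stressSpace →ₗ[ℝ] M.stressSpace →ₗ[ℝ] ℝ,
    ∀ σ φ, g σ φ = ∫ x in M.domain, ddot (M.stressField σ x) (M.stressField φ x) := by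
  have hint : ∀ σ φ : M.stressSpace,
      IntegrableOn (fun x => ddot (M.stressField σ x) (M.stressField φ x)) M.domain :=
    fun σ φ => ((piecewiseContinuous_stressField σ).ddot
      (piecewiseContinuous_stressField φ)).integrableOn
  refine exists_bilinear_of_isLinearMap (fun w => isLinearMap_integral (fun v => hint v w) ?_)
    (fun v => isLinearMap_integral (fun w => hint v w) ?_)
  · exact fun s hs x hx => ⟨fun v v' => by rw [stressField_add, ddot_add_left],
      fun c v => by rw [stressField_smul, ddot_smul_left, smul_eq_mul]⟩
  · exact fun s hs x hx => ⟨fun v v' => by rw [stressField_add, ddot_add_right],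
      fun c v => by rw [stressField_smul, ddot_smul_right, smul_eq_mul]⟩

theorem eq_zero_of_stressForm (σ : M.stressSpace)
    (h : ∫ x in M.domain, ddot (M.stressField σ x) (M.stressField σ x) = 0) : σ = 0 := by
  have h1 := ((piecewiseContinuous_stressField σ).ddot
    (piecewiseContinuous_stressField σ)).eq_zero_of_integral (fun x => ddot_self_nonneg _) h
  refine Subtype.ext (funext fun s => ?_)
  obtain ⟨x, hx⟩ := M.openCell_nonempty s.2
  have h2 := h1 s.1 s.2 x hx
  rw [stressField_of_mem σ s hx] at h2
  exact eq_zero_of_ddot_self h2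

theorem pressureField_add_of_mem {s : Finset (Space d)} (hs : s ∈ M.cells) {x : Space d}
    (hx : x ∈ openCell s) (p q : M.PressureSpace) :
    M.pressureField (p + q) x = M.pressureField p x + M.pressureField q x := by
  simp only [pressureField_of_mem _ ⟨s, hs⟩ hx, Pi.add_apply, AffineMap.coe_add]

theorem pressureField_smul_of_mem {s : Finset (Space d)} (hs : s ∈ M.cells) {x : Space d}
    (hx : x ∈ openCell s) (c : ℝ) (p : M.PressureSpace) :
    M.pressureField (c • p) x = c * M.pressureField p x := by
  simp only [pressureField_of_mem _ ⟨s, hs⟩ hx, Pi.smul_apply, AffineMap.coe_smul, smul_eq_mul]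

theorem integrableOn_pressure_divergence (q : M.PressureSpace) (v : M.velocitySpace) :
    IntegrableOn (fun x => M.pressureField q x * divergence v.1 x) M.domain :=
  ((piecewiseContinuous_pressureField q).mul (piecewiseContinuous_divergence v)).integrableOn

theorem exists_divergenceForm (M : Mesh d) :
    ∃ b : M.PressureSpace →ₗ[ℝ] M.velocitySpace →ₗ[ℝ] ℝ,
      ∀ q v, b q v = ∫ x in M.domain, M.pressureField q x * divergence v.1 x := by
  refine exists_bilinear_of_isLinearMap
    (fun w => isLinearMap_integral (fun v => integrableOn_pressure_divergence v w) ?_)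
    (fun v => isLinearMap_integral (fun w => integrableOn_pressure_divergence v w) ?_)
  · exact fun s hs x hx => ⟨fun v v' => by rw [pressureField_add_of_mem hs hx, add_mul],
      fun c v => by rw [pressureField_smul_of_mem hs hx, smul_eq_mul, mul_assoc]⟩
  · exact fun s hs x hx => ⟨fun v v' => by rw [divergence_add_of_mem hs hx, mul_add],
      fun c v => by rw [divergence_smul_of_mem hs hx, smul_eq_mul]; ring⟩

/-- The linear forms on the velocities that vanish on the weakly divergence-free ones are the
pressure forms. -/
theorem exists_pressure_of_forall_isDivFree (f : M.velocitySpace →ₗ[ℝ] ℝ)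
    (h : ∀ v, M.IsDivFree v → f v = 0) :
    ∃ p : M.PressureSpace, ∀ v, f v = ∫ x in M.domain, M.pressureField p x * divergence v.1 x := by
  obtain ⟨b, hb⟩ := exists_divergenceForm M
  have hf : f ∈ LinearMap.range b := by
    -- In finite dimension a subspace of the dual is the annihilator of its coannihilator. Existence
    -- of a pressure thus needs no inf-sup condition; its uniqueness is not claimed.
    have hsub : f ∈ (LinearMap.range b).dualCoannihilator.dualAnnihilator := by
      rw [Submodule.mem_dualAnnihilator]
      intro v hv
      refine h v fun q => ?_
      rw [← hb]
      exact (Submodule.mem_dualCoannihilator _).1 hv _ ⟨q, rfl⟩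
    rwa [Subspace.dualCoannihilator_dualAnnihilator_eq] at hsub
  obtain ⟨p, hp⟩ := hf
  exact ⟨p, fun v => by rw [← hp, hb]⟩

variable (M) in
/-- The weakly divergence-free velocities. -/
def divFree : Submodule ℝ M.velocitySpace where
  carrier := {v | M.IsDivFree v}
  add_mem' {v w} hv hw q := by
    obtain ⟨b, hb⟩ := exists_divergenceForm M
    rw [← hb, map_add, hb, hb, hv q, hw q, add_zero]
  zero_mem' q := by
    obtain ⟨b, hb⟩ := exists_divergenceForm M
    rw [← hb, map_zero]
  smul_mem' c v hv q := by
    obtain ⟨b, hb⟩ := exists_divergenceForm M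
    rw [← hb, map_smul, hb, hv q, smul_zero]

end Mesh

/-! ### The backward flow and the transported stress -/

namespace Mesh

variable {d : ℕ} {M : Mesh d}

/-- Picard–Lindelöf with data at the final time. Trajectories cannot leave the domain because all
points outside of it are equilibria of `u`. -/
theorem exists_isBackwardFlow (u : M.velocitySpace) {T : ℝ} (hT : 0 ≤ T) :
    ∃ X : ℝ → Space d → Space d, M.IsBackwardFlow u.1 T X ∧ ContinuousOn (X 0) M.domain := by
  obtain ⟨K, hK⟩ := exists_lipschitzWith_of_mem_velocitySpace u.2
  obtain ⟨C, hC⟩ := exists_norm_le_of_mem_velocitySpace u.2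
  obtain ⟨R', hR'⟩ := M.isBounded_domain.subset_closedBall 0
  set R : NNReal := R'.toNNReal
  have hR : M.domain ⊆ Metric.closedBall 0 R :=
    hR'.trans (Metric.closedBall_subset_closedBall (Real.le_coe_toNNReal R'))
  have hPL : IsPicardLindelof (fun _ : ℝ => u.1) (⟨T, right_mem_Icc.2 hT⟩ : Icc (0 : ℝ) T) 0
      -- End points range over a ball of radius `R` containing the domain; a path of speed at most
      -- `C` leaves it by at most `C * T`.
      (R + C * T.toNNReal) R C K :=
    { lipschitzOnWith := fun _ _ => hK.lipschitzOnWith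
      continuousOn := fun _ _ => continuousOn_const
      norm_le := fun _ _ x _ => hC x
      mul_max_le := by
        simp [hT] }
  obtain ⟨α, hα, L, hL⟩ := hPL.exists_forall_mem_closedBall_eq_hasDerivWithinAt_lipschitzOnWith
  refine ⟨fun t x => α x t, ⟨fun x hx t ht => ?_, fun x hx t ht => (hα x (hR hx)).2 t ht,
    fun x hx => (hα x (hR hx)).1⟩, (hL 0 (left_mem_Icc.2 hT)).continuousOn.mono hR⟩
  -- From an equilibrium at time `t`, forward uniqueness keeps the trajectory constant up to time
  -- `T`, where it must be at `x`, inside the domain.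
  by_contra hc
  have h0 : u.1 (α x t) = 0 := u.2.2.1 _ hc
  have hsub : Icc t T ⊆ Icc 0 T := Icc_subset_Icc_left ht.1
  have hder := (hα x (hR hx)).2
  have heq := ODE_solution_unique_of_mem_Icc_right (v := fun _ => u.1) (s := fun _ => univ)
    (f := α x) (g := fun _ => α x t) (K := K) (a := t) (b := T)
    (fun _ _ => hK.lipschitzOnWith)
    (fun r hr => ((hder r (hsub hr)).continuousWithinAt).mono hsub)
    (fun r hr => (hder r (hsub (Ico_subset_Icc_self hr))).mono_of_mem_nhdsWithin
      (mem_of_superset (Icc_mem_nhdsGE_of_mem ⟨ht.1.trans hr.1, hr.2⟩) (fun y hy => hy)))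
    (fun _ _ => mem_univ _) continuousOn_const
    (fun r _ => by simpa [h0] using hasDerivWithinAt_const r (Ici r) (α x t))
    (fun _ _ => mem_univ _) rfl
  have h1 : α x T = α x t := heq (right_mem_Icc.2 ht.2)
  rw [← h1, (hα x (hR hx)).1] at hc
  exact hc hx

/-- Hence the integrals of the transported stress depend on the step length only, not on the flow
chosen in the definition of a solution. -/
theorem IsBackwardFlow.eq_of_mem_domain {u : M.velocitySpace} {T : ℝ} (hT : 0 ≤ T)
    {X Y : ℝ → Space d → Space d} (hX : M.IsBackwardFlow u.1 T X) (hY : M.IsBackwardFlow u.1 T Y)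
    {x : Space d} (hx : x ∈ M.domain) : X 0 x = Y 0 x := by
  obtain ⟨K, hK⟩ := exists_lipschitzWith_of_mem_velocitySpace u.2
  have hmem : ∀ r ∈ Ioc 0 T, Icc 0 T ∈ 𝓝[≤] r := fun r hr => Icc_mem_nhdsLE_of_mem hr
  exact ODE_solution_unique_of_mem_Icc_left (v := fun _ => u.1) (s := fun _ => univ)
    (f := fun r => X r x) (g := fun r => Y r x) (K := K) (a := 0) (b := T)
    (fun _ _ => hK.lipschitzOnWith)
    (fun r hr => (hX.ode x hx r hr).continuousWithinAt)
    (fun r hr => (hX.ode x hx r (Ioc_subset_Icc_self hr)).mono_of_mem_nhdsWithin (hmem r hr))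
    (fun _ _ => mem_univ _)
    (fun r hr => (hY.ode x hx r hr).continuousWithinAt)
    (fun r hr => (hY.ode x hx r (Ioc_subset_Icc_self hr)).mono_of_mem_nhdsWithin (hmem r hr))
    (fun _ _ => mem_univ _) ((hX.final x hx).trans (hY.final x hx).symm) (left_mem_Icc.2 hT)

theorem IsBackwardFlow.norm_sub_le {u : M.velocitySpace} {T : ℝ} (hT : 0 ≤ T)
    {X : ℝ → Space d → Space d} (hX : M.IsBackwardFlow u.1 T X) {C : ℝ} (hC : ∀ x, ‖u.1 x‖ ≤ C)
    {x : Space d} (hx : x ∈ M.domain) : ‖X 0 x - x‖ ≤ C * T := by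
  have h := (convex_Icc (0 : ℝ) T).norm_image_sub_le_of_norm_hasDerivWithin_le
    (f := fun r => X r x) (hX.ode x hx) (fun r _ => hC _) (right_mem_Icc.2 hT) (left_mem_Icc.2 hT)
  simpa [hX.final x hx, abs_of_nonneg hT] using h

theorem ddot_eq_sum (A B : Matrix (Fin d) (Fin d) ℝ) : ddot A B = ∑ i, ∑ j, A i j * B i j := by
  simp [ddot, Matrix.trace, Matrix.mul_apply]

theorem measurable_stressField_apply (σ : M.stressSpace) (i j : Fin d) :
    Measurable fun x => M.stressField σ x i j := by
  have h : (fun x => M.stressField σ x i j) = fun x => ∑ s : M.cells,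
      (openCell s.1).indicator (fun _ => σ.1 s i j) x := by
    funext x
    rw [stressField, Matrix.sum_apply]
    refine Finset.sum_congr rfl fun s _ => ?_
    by_cases hx : x ∈ openCell s.1 <;> simp [hx]
  rw [h]
  exact Finset.measurable_sum _ fun s _ =>
    measurable_const.indicator isOpen_interior.measurableSet

/-- A bound for the entries of all sums of some of the values of a stress field. -/
def stressBound (σ : M.stressSpace) : ℝ := ∑ s, ∑ i, ∑ j, |σ.1 s i j|

theorem stressBound_nonneg (σ : M.stressSpace) : 0 ≤ stressBound σ := by
  unfold stressBound
  positivity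

theorem abs_sum_indicator_le (σ : M.stressSpace) (p : M.cells → Prop) [DecidablePred p]
    (i j : Fin d) : |(∑ s, if p s then σ.1 s else 0) i j| ≤ stressBound σ := by
  rw [Matrix.sum_apply]
  refine (Finset.abs_sum_le_sum_abs _ _).trans (Finset.sum_le_sum fun s _ => ?_)
  have h1 : |σ.1 s i j| ≤ ∑ i, ∑ j, |σ.1 s i j| :=
    (Finset.single_le_sum (f := fun j => |σ.1 s i j|) (fun _ _ => abs_nonneg _)
      (Finset.mem_univ j)).trans
      (Finset.single_le_sum (f := fun i => ∑ j, |σ.1 s i j|) (fun _ _ => by positivity)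
      (Finset.mem_univ i))
  split_ifs
  · exact h1
  · simpa using (abs_nonneg _).trans h1

theorem abs_stressField_apply_le (σ : M.stressSpace) (x : Space d) (i j : Fin d) :
    |M.stressField σ x i j| ≤ stressBound σ := by
  classical
  convert abs_sum_indicator_le σ (fun s => x ∈ openCell s.1) i j using 3
  unfold stressField
  exact congrFun (congrFun (Finset.sum_congr rfl fun s _ => by
    by_cases hx : x ∈ openCell s.1 <;> simp [hx] <;> rfl) i) j

theorem abs_ddot_le {A B : Matrix (Fin d) (Fin d) ℝ} {a b : ℝ} (ha : 0 ≤ a)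
    (hA : ∀ i j, |A i j| ≤ a) (hB : ∀ i j, |B i j| ≤ b) : |ddot A B| ≤ d * (d * (a * b)) := by
  rw [ddot_eq_sum]
  calc _ ≤ ∑ i, ∑ j, |A i j * B i j| := (Finset.abs_sum_le_sum_abs _ _).trans
        (Finset.sum_le_sum fun i _ => Finset.abs_sum_le_sum_abs _ _)
    _ ≤ ∑ _i : Fin d, ∑ _j : Fin d, a * b := by
        refine Finset.sum_le_sum fun i _ => Finset.sum_le_sum fun j _ => ?_
        rw [abs_mul]
        exact mul_le_mul (hA i j) (hB i j) (abs_nonneg _) ha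
    _ = _ := by simp

theorem volume_domain_lt_top : volume M.domain < ⊤ := M.isBounded_domain.measure_lt_top

theorem aestronglyMeasurable_transport (σ₀ φ : M.stressSpace) {Y : Space d → Space d}
    (hY : ContinuousOn Y M.domain) :
    AEStronglyMeasurable (fun x => ddot (M.stressField σ₀ (Y x)) (M.stressField φ x))
      (volume.restrict M.domain) := by
  simp_rw [ddot_eq_sum]
  refine AEMeasurable.aestronglyMeasurable ?_
  refine Finset.aemeasurable_fun_sum _ fun i _ => Finset.aemeasurable_fun_sum _ fun j _ => ?_
  exact ((measurable_stressField_apply σ₀ i j).comp_aemeasurable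
    (hY.aemeasurable M.isOpen_domain.measurableSet)).mul
    (measurable_stressField_apply φ i j).aemeasurable

/-- The form `φ ↦ ∫ (σ₀ ∘ X) : φ` of the transported stress, and its limit for short steps. -/
theorem exists_transportForm (u : M.velocitySpace) (σ₀ : M.stressSpace) :
    ∃ f : ℝ → M.stressSpace →ₗ[ℝ] ℝ,
      (∀ T, 0 ≤ T → ∀ X, M.IsBackwardFlow u.1 T X → ∀ φ,
        IntegrableOn (fun x => ddot (M.stressField σ₀ (X 0 x)) (M.stressField φ x)) M.domain ∧
        f T φ = ∫ x in M.domain, ddot (M.stressField σ₀ (X 0 x)) (M.stressField φ x)) ∧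
      ∀ φ, Tendsto (fun T => f T φ) (𝓝[≥] 0)
        (𝓝 (∫ x in M.domain, ddot (M.stressField σ₀ x) (M.stressField φ x))) := by
  have hex : ∀ T : ℝ, ∃ X : ℝ → Space d → Space d,
      0 ≤ T → M.IsBackwardFlow u.1 T X ∧ ContinuousOn (X 0) M.domain := fun T => by
    by_cases hT : 0 ≤ T
    · obtain ⟨X, hX⟩ := exists_isBackwardFlow u hT
      exact ⟨X, fun _ => hX⟩
    · exact ⟨fun _ x => x, fun h => absurd h hT⟩
  choose Y hY using hex
  have hbound : ∀ T φ x, ‖ddot (M.stressField σ₀ (Y T 0 x)) (M.stressField φ x)‖ ≤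
      d * (d * (stressBound σ₀ * stressBound φ)) := fun T φ x =>
    abs_ddot_le (stressBound_nonneg σ₀) (abs_stressField_apply_le σ₀ _)
      (abs_stressField_apply_le φ _)
  have hint : ∀ T, 0 ≤ T → ∀ φ,
      IntegrableOn (fun x => ddot (M.stressField σ₀ (Y T 0 x)) (M.stressField φ x)) M.domain :=
    fun T hT φ => IntegrableOn.of_bound volume_domain_lt_top
      (aestronglyMeasurable_transport σ₀ φ (hY T hT).2) _ (ae_of_all _ (hbound T φ))
  have hlin : ∀ T, 0 ≤ T → IsLinearMap ℝ fun φ =>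
      ∫ x in M.domain, ddot (M.stressField σ₀ (Y T 0 x)) (M.stressField φ x) := fun T hT =>
    isLinearMap_integral (hint T hT) fun s hs x hx =>
      ⟨fun v v' => by rw [stressField_add, ddot_add_right],
      fun c v => by rw [stressField_smul, ddot_smul_right, smul_eq_mul]⟩
  classical
  -- The value `0` for negative `T` is a dummy that the filter `𝓝[≥] 0` does not see.
  refine ⟨fun T => if h : 0 ≤ T then (hlin T h).mk' else 0, fun T hT X hX φ => ?_, fun φ => ?_⟩
  · have hXY : EqOn (fun x => ddot (M.stressField σ₀ (Y T 0 x)) (M.stressField φ x))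
        (fun x => ddot (M.stressField σ₀ (X 0 x)) (M.stressField φ x)) M.domain := fun x hx => by
      simp only [(hY T hT).1.eq_of_mem_domain hT hX hx]
    refine ⟨(hint T hT φ).congr_fun hXY M.isOpen_domain.measurableSet, ?_⟩
    beta_reduce
    rw [dif_pos hT]
    exact setIntegral_congr_fun M.isOpen_domain.measurableSet hXY
  · obtain ⟨C, hC⟩ := exists_norm_le_of_mem_velocitySpace u.2
    have hlim : Tendsto (fun T => ∫ x in M.domain,
        ddot (M.stressField σ₀ (Y T 0 x)) (M.stressField φ x)) (𝓝[≥] 0)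
        (𝓝 (∫ x in M.domain, ddot (M.stressField σ₀ x) (M.stressField φ x))) := by
      refine tendsto_integral_filter_of_dominated_convergence
        (fun _ => d * (d * (stressBound σ₀ * stressBound φ))) ?_ ?_ ?_ ?_
      · filter_upwards [self_mem_nhdsWithin] with T hT
        exact aestronglyMeasurable_transport σ₀ φ (hY T hT).2
      · exact Eventually.of_forall fun T => ae_of_all _ (hbound T φ)
      · exact integrableOn_const volume_domain_lt_top.ne
      · filter_upwards [M.ae_mem_openCell, ae_restrict_mem M.isOpen_domain.measurableSet]
          with x ⟨s, hs, hx⟩ hxd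
        have hconv : Tendsto (fun T => Y T 0 x) (𝓝[≥] 0) (𝓝 x) := by
          rw [tendsto_iff_norm_sub_tendsto_zero]
          have hz : Tendsto (fun T : ℝ => (C : ℝ) * T) (𝓝[≥] 0) (𝓝 0) := by
            have : Tendsto (fun T : ℝ => (C : ℝ) * T) (𝓝 0) (𝓝 (C * 0)) :=
              (continuous_const.mul continuous_id).tendsto _
            rw [mul_zero] at this
            exact this.mono_left nhdsWithin_le_nhds
          refine squeeze_zero' (Eventually.of_forall fun _ => norm_nonneg _) ?_ hz
          filter_upwards [self_mem_nhdsWithin] with T hT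
          exact (hY T hT).1.norm_sub_le hT hC hxd
        -- The foot of the characteristic tends to `x`, so it eventually lies in the same open
        -- element, where `σ₀` is constant: pointwise the integrand is eventually equal to its
        -- limit.
        refine tendsto_const_nhds.congr' ?_
        filter_upwards [hconv.eventually (isOpen_interior.mem_nhds hx)] with T hTx
        rw [stressField_of_mem σ₀ ⟨s, hs⟩ hx, stressField_of_mem σ₀ ⟨s, hs⟩ hTx]
    refine hlim.congr' ?_
    filter_upwards [self_mem_nhdsWithin] with T hT
    rw [dif_pos (show 0 ≤ T from hT)]
    rfl

end Mesh

/-! ### One-sided limits and the upwind form -/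

namespace Mesh

variable {d : ℕ} {M : Mesh d}

section Ray

/-- A ray issuing from `x` eventually stays in a convex set or eventually stays outside of it. -/
theorem eventually_mem_or_eventually_notMem {A : Set (Space d)} (hA : Convex ℝ A) (x w : Space d) :
    (∀ᶠ δ in 𝓝[>] (0 : ℝ), x + δ • w ∈ A) ∨ ∀ᶠ δ in 𝓝[>] (0 : ℝ), x + δ • w ∉ A := by
  by_cases h : ∃ᶠ δ in 𝓝[>] (0 : ℝ), x + δ • w ∈ A
  · left
    obtain ⟨δ₁, hδ₁, hpos⟩ := (h.and_eventually self_mem_nhdsWithin).exists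
    filter_upwards [Ioo_mem_nhdsGT (show (0 : ℝ) < δ₁ from hpos)] with δ hδ
    -- The parameters for which the line is in `A` form an interval; it contains `δ` because it
    -- contains `δ₂ < δ` and `δ₁ > δ`.
    obtain ⟨δ₂, hδ₂, hlt⟩ := (h.and_eventually (Ioo_mem_nhdsGT hδ.1)).exists
    have hconv : Convex ℝ ((AffineMap.lineMap x (x + w) : ℝ →ᵃ[ℝ] Space d) ⁻¹' A) :=
      hA.affine_preimage _
    have hmem : ∀ r : ℝ, (AffineMap.lineMap x (x + w) : ℝ →ᵃ[ℝ] Space d) r = x + r • w := fun r => by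
      simp [AffineMap.lineMap_apply, add_comm]
    have := hconv.ordConnected.out (x := δ₂) (by simpa [hmem] using hδ₂) (y := δ₁)
      (by simpa [hmem] using hδ₁) ⟨hlt.2.le, hδ.2.le⟩
    simpa [hmem] using this
  · exact Or.inr (not_frequently.1 h)

open Classical in
/-- The limit at `x` of a stress field along the ray in the direction `w`. -/
def rayLimit (σ : M.stressSpace) (x w : Space d) : Matrix (Fin d) (Fin d) ℝ :=
  ∑ s : M.cells, if ∀ᶠ δ in 𝓝[>] (0 : ℝ), x + δ • w ∈ openCell s.1 then σ.1 s else 0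

theorem tendsto_rayLimit (σ : M.stressSpace) (x w : Space d) :
    Tendsto (fun δ : ℝ => M.stressField σ (x + δ • w)) (𝓝[>] 0) (𝓝 (rayLimit σ x w)) := by
  classical
  refine tendsto_finsetSum _ fun s _ => tendsto_const_nhds.congr' ?_
  rcases eventually_mem_or_eventually_notMem
    ((convex_convexHull ℝ (s.1 : Set (Space d))).interior) x w with h | h
  · filter_upwards [h] with δ hδ
    rw [if_pos h, indicator_of_mem hδ]
  · filter_upwards [h] with δ hδ
    rw [if_neg fun hc => ((hc.and h).exists).elim fun _ hr => hr.2 hr.1, indicator_of_notMem hδ]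

theorem downstream_stressField (u : Space d → Space d) (σ : M.stressSpace) (x : Space d) :
    downstream u (M.stressField σ) x = rayLimit σ x (u x) :=
  (tendsto_rayLimit σ x (u x)).limUnder_eq

theorem upstream_stressField (u : Space d → Space d) (σ : M.stressSpace) (x : Space d) :
    upstream u (M.stressField σ) x = rayLimit σ x (-u x) := by
  refine Tendsto.limUnder_eq ?_
  have h : Tendsto (fun δ : ℝ => -δ) (𝓝[<] 0) (𝓝[>] 0) := by
    simpa using tendsto_neg_nhdsLT (a := (0 : ℝ))
  refine ((tendsto_rayLimit σ x (-u x)).comp h).congr fun δ => ?_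
  simp

theorem rayLimit_add (σ τ : M.stressSpace) (x w : Space d) :
    rayLimit (σ + τ) x w = rayLimit σ x w + rayLimit τ x w := by
  simp only [rayLimit, ← Finset.sum_add_distrib]
  refine Finset.sum_congr rfl fun s _ => ?_
  split_ifs <;> simp

theorem rayLimit_smul (c : ℝ) (σ : M.stressSpace) (x w : Space d) :
    rayLimit (c • σ) x w = c • rayLimit σ x w := by
  simp only [rayLimit, Finset.smul_sum]
  refine Finset.sum_congr rfl fun s _ => ?_
  split_ifs <;> simp

theorem abs_rayLimit_apply_le (σ : M.stressSpace) (x w : Space d) (i j : Fin d) :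
    |rayLimit σ x w i j| ≤ stressBound σ := by
  classical
  exact abs_sum_indicator_le σ (fun s => ∀ᶠ δ in 𝓝[>] (0 : ℝ), x + δ • w ∈ openCell s.1) i j

/-- A ray is eventually inside or eventually outside of a convex set, so testing along `1 / (n + 1)`
decides which; this turns the set into a countable combination of open sets. -/
theorem measurableSet_eventually_ray {w : Space d → Space d} (hw : Continuous w)
    (s : Finset (Space d)) :
    MeasurableSet {x | ∀ᶠ δ in 𝓝[>] (0 : ℝ), x + δ • w x ∈ openCell s} := by
  have hseq : Tendsto (fun n : ℕ => 1 / ((n : ℝ) + 1)) atTop (𝓝[>] 0) :=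
    tendsto_nhdsWithin_iff.2 ⟨tendsto_one_div_add_atTop_nhds_zero_nat,
      Eventually.of_forall fun n => by
        have : (0 : ℝ) < 1 / ((n : ℝ) + 1) := by positivity
        exact this⟩
  have h : {x | ∀ᶠ δ in 𝓝[>] (0 : ℝ), x + δ • w x ∈ openCell s} =
      {x | ∀ᶠ n : ℕ in atTop, x + (1 / ((n : ℝ) + 1)) • w x ∈ openCell s} := by
    ext x
    refine ⟨fun hx => hseq.eventually hx, fun hx => ?_⟩
    rcases eventually_mem_or_eventually_notMem
      ((convex_convexHull ℝ (s : Set (Space d))).interior) x (w x) with h | h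
    · exact h
    · obtain ⟨n, hn⟩ := ((hseq.eventually h).and hx).exists
      exact absurd hn.2 hn.1
  rw [h]
  simp only [eventually_atTop, ofPred_exists, ofPred_forall]
  refine MeasurableSet.iUnion fun n => MeasurableSet.iInter fun k => MeasurableSet.iInter fun _ => ?_
  exact (isOpen_interior.preimage (by fun_prop :
    Continuous fun x => x + (1 / ((k : ℝ) + 1)) • w x)).measurableSet

theorem measurable_rayLimit_apply (σ : M.stressSpace) {w : Space d → Space d} (hw : Continuous w)
    (i j : Fin d) : Measurable fun x => rayLimit σ x (w x) i j := by
  classical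
  simp only [rayLimit, Matrix.sum_apply]
  refine Finset.measurable_fun_sum _ fun s _ => ?_
  have hm : Measurable fun x =>
      if ∀ᶠ δ in 𝓝[>] (0 : ℝ), x + δ • w x ∈ openCell s.1 then σ.1 s i j else 0 :=
    Measurable.ite (measurableSet_eventually_ray hw s.1) measurable_const measurable_const
  convert hm using 2 with x
  split_ifs <;> rfl

end Ray

/-- The `n`-dimensional surface measure of a simplex with at most `n + 1` vertices is finite. -/
theorem euclideanHausdorffMeasure_convexHull_lt_top (t : Finset (Space d)) {n : ℕ}
    (ht : t.card = n + 1) :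
    Measure.euclideanHausdorffMeasure n (convexHull ℝ (t : Set (Space d))) < ⊤ := by
  classical
  obtain ⟨p₀, hp₀⟩ : t.Nonempty := Finset.card_pos.1 (by omega)
  let L : ({q // q ∈ t.erase p₀} → ℝ) →L[ℝ] Space d :=
    ∑ p : {q // q ∈ t.erase p₀}, (ContinuousLinearMap.proj p).smulRight (p.1 - p₀)
  have hL : ∀ c, L c = ∑ p : {q // q ∈ t.erase p₀}, c p • (p.1 - p₀) := fun c => by
    simp [L]
  have hlip : LipschitzWith ‖L‖₊ fun c => p₀ + L c := LipschitzWith.of_dist_le_mul fun x y => by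
    rw [dist_add_left]
    exact L.lipschitz.dist_le_mul x y
  have hsub : convexHull ℝ (t : Set (Space d)) ⊆ (fun c => p₀ + L c) '' Icc 0 1 := by
    -- Dropping the barycentric coordinate of `p₀` exhibits the simplex as part of a Lipschitz image
    -- of the unit cube with exactly `n` coordinates.
    intro x hx
    obtain ⟨w, hw0, hw1, rfl⟩ := Finset.mem_convexHull'.1 hx
    refine ⟨fun p => w p.1, ⟨fun p => hw0 _ (Finset.mem_of_mem_erase p.2), fun p => ?_⟩, ?_⟩
    · change w p.1 ≤ 1
      rw [← hw1]
      exact Finset.single_le_sum hw0 (Finset.mem_of_mem_erase p.2)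
    · simp only [hL]
      rw [Finset.sum_coe_sort (t.erase p₀) fun p => w p • (p - p₀)]
      simp only [smul_sub, Finset.sum_sub_distrib, ← Finset.sum_smul]
      have h : w p₀ = 1 - ∑ p ∈ t.erase p₀, w p := by
        rw [← Finset.add_sum_erase t w hp₀] at hw1
        linarith
      rw [← Finset.add_sum_erase t (fun p => w p • p) hp₀, h, sub_smul, one_smul]
      abel
  rw [Measure.euclideanHausdorffMeasure_def, Measure.smul_apply]
  refine ENNReal.mul_lt_top ENNReal.coe_lt_top ?_
  refine (measure_mono hsub).trans_lt ?_
  refine (hlip.hausdorffMeasure_image_le n.cast_nonneg _).trans_lt ?_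
  refine ENNReal.mul_lt_top (by simp) ?_
  have hcard : (n : ℝ) = Fintype.card {q // q ∈ t.erase p₀} := by
    simp [Finset.card_erase_of_mem hp₀, ht]
  rw [hcard, hausdorffMeasure_pi_real]
  exact isCompact_Icc.measure_lt_top

/-- The one-sided limits are linear in the stress, bounded and measurable, and the facets have
finite surface measure; so every integral converges and bilinearity passes to the sum. -/
theorem exists_jumpForm (hd : 0 < d) (u : M.velocitySpace) :
    ∃ j : M.stressSpace →ₗ[ℝ] M.stressSpace →ₗ[ℝ] ℝ, ∀ σ φ, j σ φ = M.jumpTerm u σ φ := by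
  let D : Finset (Space d) → M.stressSpace → M.stressSpace → Space d → ℝ := fun t σ φ x =>
    absNormal t (u.1 x) * ddot (rayLimit σ x (u.1 x) - rayLimit σ x (-u.1 x))
      (rayLimit φ x (u.1 x))
  have hjump : ∀ σ φ, M.jumpTerm u σ φ = ∑ t ∈ M.internalFacets,
      ∫ x in convexHull ℝ (t : Set (Space d)), D t σ φ x
        ∂(Measure.euclideanHausdorffMeasure (d - 1)) := fun σ φ => by
    unfold jumpTerm
    simp only [downstream_stressField, upstream_stressField, D]
  obtain ⟨C, hC⟩ := exists_norm_le_of_mem_velocitySpace u.2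
  have hmeas : ∀ t σ φ, Measurable (D t σ φ) := by
    intro t σ φ
    have h1 : Measurable fun x => absNormal t (u.1 x) := by
      have : Continuous fun x => absNormal t (u.1 x) := by
        have := u.2.1
        unfold absNormal
        fun_prop
      exact this.measurable
    refine h1.mul ?_
    simp_rw [ddot_eq_sum]
    refine Finset.measurable_fun_sum _ fun i _ => Finset.measurable_fun_sum _ fun j _ => ?_
    exact ((measurable_rayLimit_apply σ u.2.1 i j).sub
      (measurable_rayLimit_apply σ u.2.1.neg i j)).mul (measurable_rayLimit_apply φ u.2.1 i j)
  have hbound : ∀ t σ φ x, ‖D t σ φ x‖ ≤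
      C * (d * (d * ((stressBound σ + stressBound σ) * stressBound φ))) := by
    intro t σ φ x
    rw [Real.norm_eq_abs, abs_mul]
    refine mul_le_mul ?_ ?_ (abs_nonneg _) C.2
    · rw [absNormal, abs_norm]
      exact (Submodule.norm_starProjection_apply_le _ _).trans (hC x)
    · have := stressBound_nonneg σ
      refine abs_ddot_le (by positivity) (fun i j => ?_) (abs_rayLimit_apply_le φ _ _)
      exact (abs_sub _ _).trans
        (add_le_add (abs_rayLimit_apply_le σ _ _ i j) (abs_rayLimit_apply_le σ _ _ i j))
  have hint : ∀ t ∈ M.internalFacets, ∀ σ φ, IntegrableOn (D t σ φ)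
      (convexHull ℝ (t : Set (Space d))) (Measure.euclideanHausdorffMeasure (d - 1)) := by
    intro t ht σ φ
    have hcard : t.card = d - 1 + 1 := by
      simp only [internalFacets, Finset.mem_image, Finset.mem_filter] at ht
      obtain ⟨st, ⟨-, -, h⟩, rfl⟩ := ht
      omega
    exact IntegrableOn.of_bound (euclideanHausdorffMeasure_convexHull_lt_top t hcard)
      (hmeas t σ φ).aestronglyMeasurable _ (ae_of_all _ (hbound t σ φ))
  have hlin : ∀ (E : Finset (Space d) → M.stressSpace → Space d → ℝ),
      (∀ t ∈ M.internalFacets, ∀ σ, IntegrableOn (E t σ) (convexHull ℝ (t : Set (Space d)))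
        (Measure.euclideanHausdorffMeasure (d - 1))) →
      (∀ t x, IsLinearMap ℝ fun σ => E t σ x) →
      IsLinearMap ℝ fun σ => ∑ t ∈ M.internalFacets, ∫ x in convexHull ℝ (t : Set (Space d)),
        E t σ x ∂(Measure.euclideanHausdorffMeasure (d - 1)) := by
    intro E hE hl
    refine ⟨fun σ τ => ?_, fun c σ => ?_⟩
    · rw [← Finset.sum_add_distrib]
      refine Finset.sum_congr rfl fun t ht => ?_
      rw [← integral_add (hE t ht σ) (hE t ht τ)]
      simp only [(hl t _).map_add]
    · rw [smul_eq_mul, Finset.mul_sum]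
      refine Finset.sum_congr rfl fun t ht => ?_
      rw [← integral_const_mul]
      simp only [(hl t _).map_smul, smul_eq_mul]
  obtain ⟨j, hj⟩ := exists_bilinear_of_isLinearMap (f := fun σ φ => M.jumpTerm u σ φ)
    (fun φ => by
      simp only [hjump]
      refine hlin (fun t σ => D t σ φ) (fun t ht σ => hint t ht σ φ) fun t x =>
        ⟨fun σ τ => ?_, fun c σ => ?_⟩
      · simp only [D, rayLimit_add, ddot_sub_left, ddot_add_left]
        ring
      · simp only [D, rayLimit_smul, ddot_sub_left, ddot_smul_left, smul_eq_mul]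
        ring)
    (fun σ => by
      simp only [hjump]
      refine hlin (fun t φ => D t σ φ) (fun t ht φ => hint t ht σ φ) fun t x =>
        ⟨fun φ τ => ?_, fun c φ => ?_⟩
      · simp only [D, rayLimit_add, ddot_add_right]
        ring
      · simp only [D, rayLimit_smul, ddot_smul_right, smul_eq_mul]
        ring)
  exact ⟨j, hj⟩

end Mesh

/-! ### From bilinear forms to inner product spaces -/

section InnerForms

/-- The inner product given by a symmetric positive definite bilinear form. -/
@[reducible]
def innerCore {V : Type*} [AddCommGroup V] [Module ℝ V] (a : V →ₗ[ℝ] V →ₗ[ℝ] ℝ)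
    (ha : ∀ v w, a v w = a w v) (ha0 : ∀ v, 0 ≤ a v v) (ha1 : ∀ v, a v v = 0 → v = 0) :
    InnerProductSpace.Core ℝ V where
  inner v w := a v w
  conj_inner_symm v w := ha w v
  re_inner_nonneg := ha0
  add_left u v w := by simp
  smul_left u v c := by simp
  definite := ha1

/-- `exists_unique_step` for spaces whose inner products are given by bilinear forms `a` and `g`,
with neighbourhoods described by finitely many linear forms `F i`. -/
theorem exists_unique_step_of_forms {V S ι : Type*} [AddCommGroup V] [Module ℝ V]
    [FiniteDimensional ℝ V] [AddCommGroup S] [Module ℝ S] [FiniteDimensional ℝ S] [Fintype ι]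
    (a : V →ₗ[ℝ] V →ₗ[ℝ] ℝ) (ha : ∀ v w, a v w = a w v) (ha0 : ∀ v, 0 ≤ a v v)
    (ha1 : ∀ v, a v v = 0 → v = 0)
    (g : S →ₗ[ℝ] S →ₗ[ℝ] ℝ) (hg : ∀ v w, g v w = g w v) (hg0 : ∀ v, 0 ≤ g v v)
    (hg1 : ∀ v, g v v = 0 → v = 0)
    (m c : V →ₗ[ℝ] V →ₗ[ℝ] ℝ) (hm : ∀ v, v ≠ 0 → 0 < m v v)
    (ℓ : V →ₗ[ℝ] ℝ) (b : S →ₗ[ℝ] V →ₗ[ℝ] ℝ) (B : V →ₗ[ℝ] S →ₗ[ℝ] S →ₗ[ℝ] ℝ) (e : S)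
    (hB : ∀ v σ, B v σ e = 2 * b σ v) (j : S →ₗ[ℝ] S →ₗ[ℝ] ℝ) (P : Set S) (σ₀ : S)
    (F : ι → S →ₗ[ℝ] ℝ) {r₁ : ℝ} (hr₁ : 0 < r₁)
    (hball : ∀ σ, (∀ i, |F i (σ - σ₀)| ≤ r₁) → σ ∈ P) {K : ℝ} (hK : 0 ≤ K)
    (hPK : ∀ σ ∈ P, g σ σ ≤ (K * g σ e) ^ 2) (hPe : ∀ σ ∈ P, 0 ≤ g σ e)
    (s : ℝ → S →ₗ[ℝ] ℝ) (hs : ∀ φ, Tendsto (fun t => s t φ) (𝓝[≥] 0) (𝓝 (g σ₀ φ)))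
    {Re κ η θ : ℝ} (hRe : 0 ≤ Re) (hκ : 0 < κ) (hη : 0 ≤ η) (hθ : 0 ≤ θ) :
    ∃ c₀ : ℝ, 0 < c₀ ∧ ∀ t, 0 ≤ t → t < c₀ → (0 < t ∨ 0 < Re) → ∃! w : V × S,
      w.2 ∈ P ∧ ∀ v φ, Re * (m w.1 v - ℓ v) + (g w.2 φ - s t φ)
        + t * (Re * c w.1 v + κ * a w.1 v + η * b w.2 v - B w.1 w.2 φ
        + θ * (g w.2 φ - g e φ) + j w.2 φ) = 0 := by
  -- The inner products are by definition `a` and `g`, so the conclusion of `exists_unique_step`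
  -- unfolds to the goal. The norm on `S` exists only inside this proof, which is why neighbourhoods
  -- were given by linear forms.
  let _ : NormedAddCommGroup V := (innerCore a ha ha0 ha1).toNormedAddCommGroup
  let _ : InnerProductSpace ℝ V := .ofCore (innerCore a ha ha0 ha1).toCore
  let _ : NormedAddCommGroup S := (innerCore g hg hg0 hg1).toNormedAddCommGroup
  let _ : InnerProductSpace ℝ S := .ofCore (innerCore g hg hg0 hg1).toCore
  have hFb : ∀ i, ∃ C : ℝ, 0 ≤ C ∧ ∀ x, |F i x| ≤ C * ‖x‖ := fun i => exists_linear_bound (F i)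
  choose C hC hF using hFb
  have hsum : 0 ≤ ∑ i, C i := Finset.sum_nonneg fun i _ => hC i
  have hball' : ∀ σ, ‖σ - σ₀‖ ≤ r₁ / (∑ i, C i + 1) → σ ∈ P := fun σ h => hball σ fun i => by
    rw [le_div_iff₀ (by positivity)] at h
    have h1 : C i ≤ ∑ i, C i + 1 :=
      (Finset.single_le_sum (fun i _ => hC i) (Finset.mem_univ i)).trans (by linarith)
    calc |F i (σ - σ₀)| ≤ C i * ‖σ - σ₀‖ := hF i _
      _ ≤ (∑ i, C i + 1) * ‖σ - σ₀‖ := mul_le_mul_of_nonneg_right h1 (norm_nonneg _)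
      _ ≤ r₁ := by linarith
  have hnorm : ∀ σ : S, ‖σ‖ ^ 2 = g σ σ := fun σ => (real_inner_self_eq_norm_sq σ).symm
  exact exists_unique_step m c hm ℓ b B e hB j P σ₀ (by positivity) hball' K
    (fun σ hσ => abs_le_of_sq_le_sq' ((hnorm σ).trans_le (hPK σ hσ))
      (mul_nonneg hK (hPe σ hσ)) |>.2) hPe s hs hRe hκ hη hθ

end InnerForms

/-! ### Positive definite stresses -/

section PosDef

variable {d : ℕ}

/-- Evaluating the quadratic form at the sum and the difference of two basis vectors bounds `2 * |A
i j|` by `A i i + A j j`. -/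
theorem abs_apply_le_trace_of_posDef {A : Matrix (Fin d) (Fin d) ℝ} (hA : A.PosDef) (i j : Fin d) :
    |A i j| ≤ A.trace := by
  have hq : ∀ x : Fin d → ℝ, 0 ≤ x ⬝ᵥ (A *ᵥ x) := fun x => hA.posSemidef.dotProduct_mulVec_nonneg x
  have hsymm : A j i = A i j := hA.1.apply i j
  have h1 := hq (Pi.single i 1 + Pi.single j 1)
  have h2 := hq (Pi.single i 1 - Pi.single j 1)
  simp [Matrix.mulVec_add, Matrix.mulVec_sub, add_dotProduct, sub_dotProduct, hsymm] at h1 h2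
  have hdiag : ∀ k, 0 ≤ A k k := fun k => by simpa using hq (Pi.single k 1)
  have htr : ∀ k, A k k ≤ A.trace := fun k =>
    Finset.single_le_sum (f := fun k => A k k) (fun k _ => hdiag k) (Finset.mem_univ k)
  have := htr i
  have := htr j
  rw [abs_le]
  constructor <;> linarith

/-- Openness of positive definiteness: with coercivity constant `c` for the sup norm, a perturbation
with entries at most `c / (d * d + 1)` changes the quadratic form by less than `c * ‖x‖ ^ 2`. -/
theorem exists_posDef_of_abs_sub_le {A : Matrix (Fin d) (Fin d) ℝ} (hA : A.PosDef) :
    ∃ r : ℝ, 0 < r ∧ ∀ B : Matrix (Fin d) (Fin d) ℝ, B.IsSymm → (∀ i j, |B i j - A i j| ≤ r) →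
      B.PosDef := by
  obtain ⟨c, hc, h⟩ := exists_coercive_bound (Matrix.toLinearMap₂' ℝ A) fun x hx => by
    rw [Matrix.toLinearMap₂'_apply']
    exact hA.dotProduct_mulVec_pos hx
  refine ⟨c / (d * d + 1), by positivity, fun B hB hAB => ?_⟩
  refine .of_dotProduct_mulVec_pos hB fun x hx => ?_
  have h1 := h x
  rw [Matrix.toLinearMap₂'_apply'] at h1
  have h2 : |x ⬝ᵥ ((B - A) *ᵥ x)| ≤ d * d * (c / (d * d + 1) * ‖x‖ ^ 2) := by
    simp only [dotProduct, Matrix.mulVec, Finset.mul_sum]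
    calc _ ≤ ∑ i, ∑ j, |x i * ((B - A) i j * x j)| := (Finset.abs_sum_le_sum_abs _ _).trans
          (Finset.sum_le_sum fun i _ => Finset.abs_sum_le_sum_abs _ _)
      _ ≤ ∑ _i : Fin d, ∑ _j : Fin d, c / (d * d + 1) * ‖x‖ ^ 2 := by
          refine Finset.sum_le_sum fun i _ => Finset.sum_le_sum fun j _ => ?_
          rw [abs_mul, abs_mul]
          calc |x i| * (|(B - A) i j| * |x j|) ≤ ‖x‖ * (c / (d * d + 1) * ‖x‖) := by
                gcongr
                · exact norm_le_pi_norm x i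
                · exact hAB i j
                · exact norm_le_pi_norm x j
            _ = _ := by ring
      _ = _ := by simp; ring
  have h3 : x ⬝ᵥ (B *ᵥ x) = x ⬝ᵥ (A *ᵥ x) + x ⬝ᵥ ((B - A) *ᵥ x) := by
    rw [Matrix.sub_mulVec, dotProduct_sub]
    ring
  have h4 : d * d * (c / (d * d + 1) * ‖x‖ ^ 2) < c * ‖x‖ ^ 2 := by
    have hx' : 0 < ‖x‖ ^ 2 := by
      have := norm_pos_iff.2 hx
      positivity
    have h5 : (d * d : ℝ) * (c / (d * d + 1) * ‖x‖ ^ 2)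
        = c * ‖x‖ ^ 2 - c / (d * d + 1) * ‖x‖ ^ 2 := by
      field_simp
      ring
    have : 0 < c / (d * d + 1) * ‖x‖ ^ 2 := by positivity
    linarith
  have h6 := (abs_le.1 h2).1
  change 0 < x ⬝ᵥ (B *ᵥ x)
  rw [h3]
  linarith

end PosDef

namespace Mesh

variable {d : ℕ} {M : Mesh d}

theorem exists_isSPD_of_abs_sub_le {σ₀ : M.stressSpace} (hσ₀ : M.IsSPD σ₀) :
    ∃ r : ℝ, 0 < r ∧ ∀ σ : M.stressSpace, (∀ s i j, |σ.1 s i j - σ₀.1 s i j| ≤ r) → M.IsSPD σ := by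
  choose r hr h using fun s => exists_posDef_of_abs_sub_le (hσ₀ s)
  obtain ⟨r', hr', hle⟩ : ∃ r' : ℝ, 0 < r' ∧ ∀ s, r' ≤ r s := by
    rcases isEmpty_or_nonempty M.cells with hE | hE
    · exact ⟨1, one_pos, fun s => hE.elim s⟩
    · obtain ⟨s, hs⟩ := Finite.exists_min r
      exact ⟨r s, hr s, hs⟩
  exact ⟨r', hr', fun σ hσ s => h s _ (σ.2 s) fun i j => (hσ s i j).trans (hle s)⟩

theorem trace_stressField_nonneg {σ : M.stressSpace} (hσ : M.IsSPD σ) (x : Space d) :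
    0 ≤ (M.stressField σ x).trace := by
  rw [stressField, Matrix.trace_sum]
  refine Finset.sum_nonneg fun s _ => ?_
  by_cases hx : x ∈ openCell s.1
  · simpa [hx] using (hσ s).posSemidef.trace_nonneg
  · simp [hx]

theorem integrableOn_trace_stressField (σ : M.stressSpace) :
    IntegrableOn (fun x => (M.stressField σ x).trace) M.domain :=
  ((piecewiseContinuous_stressField σ).comp (k := Matrix.trace) (by fun_prop)).integrableOn

/-- On each element the trace bounds all entries, and the nonnegative trace there is at most the
total trace integral divided by the volume of the element. `K` therefore depends on the mesh. -/
theorem exists_integral_ddot_self_le (M : Mesh d) : ∃ K : ℝ, 0 ≤ K ∧ ∀ σ : M.stressSpace,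
    M.IsSPD σ → ∫ x in M.domain, ddot (M.stressField σ x) (M.stressField σ x) ≤
      (K * ∫ x in M.domain, (M.stressField σ x).trace) ^ 2 := by
  have hvol : ∀ s : M.cells, 0 < volume.real (openCell s.1) := fun s =>
    ENNReal.toReal_pos (isOpen_interior.measure_pos volume (M.openCell_nonempty s.2)).ne'
      ((isCompact_closedCell s.1).isBounded.subset interior_subset).measure_lt_top.ne
  set κ : ℝ := ∑ s : M.cells, (volume.real (openCell s.1))⁻¹ with hκ
  have hκ0 : 0 ≤ κ := Finset.sum_nonneg fun s _ => (inv_pos.2 (hvol s)).le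
  refine ⟨√(volume.real M.domain) * d * κ, by positivity, fun σ hσ => ?_⟩
  set T : ℝ := ∫ x in M.domain, (M.stressField σ x).trace
  have htr : ∀ s : M.cells, (σ.1 s).trace ≤ κ * T := fun s => by
    have h1 : ∫ x in openCell s.1, (M.stressField σ x).trace ≤ T :=
      setIntegral_mono_set (integrableOn_trace_stressField σ)
        (ae_of_all _ (trace_stressField_nonneg hσ))
        (M.openCell_subset_domain s.2).eventuallyLE
    have h2 : ∫ x in openCell s.1, (M.stressField σ x).trace =
        volume.real (openCell s.1) * (σ.1 s).trace := by
      rw [setIntegral_congr_fun (g := fun _ => (σ.1 s).trace) isOpen_interior.measurableSet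
        fun x hx => by simp only [stressField_of_mem σ s hx]]
      simp
    rw [h2] at h1
    have hT : 0 ≤ T := integral_nonneg (trace_stressField_nonneg hσ)
    calc (σ.1 s).trace = (volume.real (openCell s.1))⁻¹ *
          (volume.real (openCell s.1) * (σ.1 s).trace) := by
            rw [inv_mul_cancel_left₀ (hvol s).ne']
      _ ≤ (volume.real (openCell s.1))⁻¹ * T :=
          mul_le_mul_of_nonneg_left h1 (inv_pos.2 (hvol s)).le
      _ ≤ κ * T := mul_le_mul_of_nonneg_right
          (Finset.single_le_sum (f := fun s : M.cells => (volume.real (openCell s.1))⁻¹)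
            (fun s _ => (inv_pos.2 (hvol s)).le) (Finset.mem_univ s)) hT
  have hle : ∀ᵐ x ∂(volume.restrict M.domain),
      ddot (M.stressField σ x) (M.stressField σ x) ≤ d * (d * (κ * T * (κ * T))) := by
    filter_upwards [M.ae_mem_openCell] with x ⟨s, hs, hx⟩
    rw [stressField_of_mem σ ⟨s, hs⟩ hx]
    have h1 : ∀ i j, |σ.1 ⟨s, hs⟩ i j| ≤ κ * T := fun i j =>
      (abs_apply_le_trace_of_posDef (hσ _) i j).trans (htr _)
    have h0 : 0 ≤ κ * T := (hσ ⟨s, hs⟩).posSemidef.trace_nonneg.trans (htr _)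
    exact (le_abs_self _).trans (abs_ddot_le h0 h1 h1)
  calc _ ≤ ∫ _ in M.domain, (d * (d * (κ * T * (κ * T))) : ℝ) :=
        integral_mono_ae ((piecewiseContinuous_stressField σ).ddot
          (piecewiseContinuous_stressField σ)).integrableOn
          (integrableOn_const volume_domain_lt_top.ne) hle
    _ = volume.real M.domain * (d * κ * T) ^ 2 := by
        rw [setIntegral_const, smul_eq_mul]
        ring
    _ = (√(volume.real M.domain) * d * κ * T) ^ 2 := by
        have := Real.sq_sqrt (measureReal_nonneg (μ := volume) (s := M.domain))
        nth_rw 1 [← this]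
        ring

end Mesh

/-! ### Reduction of the schemes to the abstract step -/

namespace Mesh

variable {d : ℕ} {M : Mesh d}

variable (M) in
/-- The constant stress `I`. -/
def unitStress : M.stressSpace := ⟨fun _ => 1, fun _ => Matrix.isSymm_one⟩

theorem stressField_unitStress {s : Finset (Space d)} (hs : s ∈ M.cells) {x : Space d}
    (hx : x ∈ openCell s) : M.stressField M.unitStress x = 1 :=
  stressField_of_mem M.unitStress ⟨s, hs⟩ hx

variable (M) in
/-- `f` is integrable over the domain, with integral `a`. -/
def HasDomainIntegral (f : Space d → ℝ) (a : ℝ) : Prop :=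
  IntegrableOn f M.domain ∧ ∫ x in M.domain, f x = a

namespace HasDomainIntegral

variable {f g : Space d → ℝ} {a b : ℝ}

theorem of_piecewiseContinuous (hf : M.PiecewiseContinuous f) :
    M.HasDomainIntegral f (∫ x in M.domain, f x) := ⟨hf.integrableOn, rfl⟩

theorem add (hf : M.HasDomainIntegral f a) (hg : M.HasDomainIntegral g b) :
    M.HasDomainIntegral (fun x => f x + g x) (a + b) :=
  ⟨hf.1.add hg.1, by rw [integral_add hf.1 hg.1, hf.2, hg.2]⟩

theorem sub (hf : M.HasDomainIntegral f a) (hg : M.HasDomainIntegral g b) :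
    M.HasDomainIntegral (fun x => f x - g x) (a - b) :=
  ⟨hf.1.sub hg.1, by rw [integral_sub hf.1 hg.1, hf.2, hg.2]⟩

theorem const_mul (c : ℝ) (hf : M.HasDomainIntegral f a) :
    M.HasDomainIntegral (fun x => c * f x) (c * a) :=
  ⟨hf.1.const_mul c, by rw [integral_const_mul, hf.2]⟩

theorem div_const (c : ℝ) (hf : M.HasDomainIntegral f a) :
    M.HasDomainIntegral (fun x => f x / c) (a / c) :=
  ⟨hf.1.div_const c, by rw [integral_div, hf.2]⟩

theorem neg (hf : M.HasDomainIntegral f a) : M.HasDomainIntegral (fun x => -f x) (-a) :=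
  ⟨hf.1.neg, by rw [integral_neg, hf.2]⟩

end HasDomainIntegral

theorem hasDomainIntegral_stress (σ φ : M.stressSpace) :
    M.HasDomainIntegral (fun x => ddot (M.stressField σ x) (M.stressField φ x))
      (∫ x in M.domain, ddot (M.stressField σ x) (M.stressField φ x)) :=
  .of_piecewiseContinuous
    ((piecewiseContinuous_stressField σ).ddot (piecewiseContinuous_stressField φ))

theorem hasDomainIntegral_velocity (v w : M.velocitySpace) :
    M.HasDomainIntegral (fun x => inner ℝ (v.1 x) (w.1 x))
      (∫ x in M.domain, inner ℝ (v.1 x) (w.1 x)) :=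
  .of_piecewiseContinuous ((piecewiseContinuous_velocity v).inner (piecewiseContinuous_velocity w))

theorem hasDomainIntegral_timeDensity (Re : ℝ) (u₀ u v : M.velocitySpace) (σ φ : M.stressSpace)
    {τ : Space d → Matrix (Fin d) (Fin d) ℝ} {a : ℝ}
    (hτ : M.HasDomainIntegral (fun x => ddot (τ x) (M.stressField φ x)) a) :
    M.HasDomainIntegral (timeDensity Re u₀.1 u.1 v.1 τ (M.stressField σ) (M.stressField φ))
      (Re * ((∫ x in M.domain, inner ℝ (u.1 x) (v.1 x)) - ∫ x in M.domain, inner ℝ (u₀.1 x) (v.1 x))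
      + ((∫ x in M.domain, ddot (M.stressField σ x) (M.stressField φ x)) - a)) := by
  convert (((hasDomainIntegral_velocity u v).sub (hasDomainIntegral_velocity u₀ v)).const_mul Re).add
    ((hasDomainIntegral_stress σ φ).sub hτ) using 1
  funext x
  rw [timeDensity, inner_sub_left, ddot_sub_left]

theorem integral_ddot_unitStress (φ : M.stressSpace) :
    ∫ x in M.domain, ddot (M.stressField M.unitStress x) (M.stressField φ x) =
      ∫ x in M.domain, ddot 1 (M.stressField φ x) :=
  M.setIntegral_congr_openCell fun s hs x hx => by
    simp only [stressField_unitStress hs hx]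

theorem integral_ddot_unitStress_right (σ : M.stressSpace) :
    ∫ x in M.domain, ddot (M.stressField σ x) (M.stressField M.unitStress x) =
      ∫ x in M.domain, (M.stressField σ x).trace :=
  M.setIntegral_congr_openCell fun s hs x hx => by
    simp [stressField_unitStress hs hx, ddot]

variable (M) in
/-- The terms of the scheme that are of order zero in time, apart from the upwind term. -/
def spaceForm (Re Wi ε : ℝ) (u₀ u v : M.velocitySpace) (σ φ : M.stressSpace) : ℝ :=
  Re * (∫ x in M.domain, inner ℝ (convect u₀.1 u.1 x) (v.1 x))
    + (1 - ε) * (∫ x in M.domain, ddot (grad u.1 x) (grad v.1 x))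
    + ε / Wi * (∫ x in M.domain, ddot (M.stressField σ x) (grad v.1 x))
    - (∫ x in M.domain, ddot (grad u.1 x * M.stressField σ x
        + M.stressField σ x * (grad u.1 x)ᵀ) (M.stressField φ x))
    + 1 / Wi * ((∫ x in M.domain, ddot (M.stressField σ x) (M.stressField φ x))
      - ∫ x in M.domain, ddot (M.stressField M.unitStress x) (M.stressField φ x))

theorem hasDomainIntegral_spaceDensity (Re Wi ε : ℝ) (u₀ u v : M.velocitySpace)
    (σ φ : M.stressSpace) :
    M.HasDomainIntegral (spaceDensity Re Wi ε u₀.1 u.1 v.1 (M.stressField σ) (M.stressField φ))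
      (M.spaceForm Re Wi ε u₀ u v σ φ) := by
  have h1 := HasDomainIntegral.of_piecewiseContinuous ((piecewiseContinuous_convect u₀ u).inner
    (piecewiseContinuous_velocity v))
  have h2 := HasDomainIntegral.of_piecewiseContinuous ((piecewiseContinuous_grad u).ddot
    (piecewiseContinuous_grad v))
  have h3 := HasDomainIntegral.of_piecewiseContinuous ((piecewiseContinuous_stressField σ).ddot
    (piecewiseContinuous_grad v))
  have h4 := HasDomainIntegral.of_piecewiseContinuous ((piecewiseContinuous_upperConvected u σ).ddot
    (piecewiseContinuous_stressField φ))
  have h6 := HasDomainIntegral.of_piecewiseContinuous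
    ((PiecewiseContinuous.of_continuous (M := M)
      (continuous_const (y := (1 : Matrix (Fin d) (Fin d) ℝ)))).ddot
      (piecewiseContinuous_stressField φ))
  rw [← integral_ddot_unitStress] at h6
  rw [spaceForm]
  convert ((((h1.const_mul Re).add (h2.const_mul (1 - ε))).add (h3.const_mul (ε / Wi))).sub h4).add
    (((hasDomainIntegral_stress σ φ).sub h6).const_mul (1 / Wi)) using 1
  funext x
  rw [spaceDensity, ddot_sub_left _ 1]

theorem hasDomainIntegral_pressureDensity (p q : M.PressureSpace) (u v : M.velocitySpace) :
    M.HasDomainIntegral (pressureDensity (M.pressureField p) (M.pressureField q) u.1 v.1)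
      (-(∫ x in M.domain, M.pressureField p x * divergence v.1 x)
        + ∫ x in M.domain, M.pressureField q x * divergence u.1 x) := by
  have h : ∀ (q : M.PressureSpace) (v : M.velocitySpace),
      M.HasDomainIntegral (fun x => M.pressureField q x * divergence v.1 x)
        (∫ x in M.domain, M.pressureField q x * divergence v.1 x) := fun q v =>
    ⟨integrableOn_pressure_divergence q v, rfl⟩
  convert (h p v).neg.add (h q u) using 1
  funext x
  rw [pressureDensity, neg_mul]

variable (M) in
/-- The residual of the pressure-free scheme multiplied by the time step `T`, for the form `f` of
the transported stress and the upwind form `J`. -/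
def residual (Re Wi ε T : ℝ) (u₀ : M.velocitySpace) (f : M.stressSpace →ₗ[ℝ] ℝ)
    (J : M.stressSpace →ₗ[ℝ] M.stressSpace →ₗ[ℝ] ℝ) (u : M.velocitySpace) (σ : M.stressSpace)
    (v : M.velocitySpace) (φ : M.stressSpace) : ℝ :=
  Re * ((∫ x in M.domain, inner ℝ (u.1 x) (v.1 x)) - ∫ x in M.domain, inner ℝ (u₀.1 x) (v.1 x))
    + ((∫ x in M.domain, ddot (M.stressField σ x) (M.stressField φ x)) - f φ)
    + T * (M.spaceForm Re Wi ε u₀ u v σ φ + J σ φ)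

variable (M) in
/-- `(u, σ)` solves the pressure-free scheme. -/
def SolvesResidual (Re Wi ε T : ℝ) (u₀ : M.velocitySpace) (f : M.stressSpace →ₗ[ℝ] ℝ)
    (J : M.stressSpace →ₗ[ℝ] M.stressSpace →ₗ[ℝ] ℝ) (u : M.velocitySpace) (σ : M.stressSpace) :
    Prop :=
  M.IsDivFree u ∧ ∀ v φ, M.IsDivFree v → M.residual Re Wi ε T u₀ f J u σ v φ = 0

/-- The abstract step on the weakly divergence-free velocities, with the Dirichlet form and the `L²`
form of the stresses as inner products and with `κ = 1 - ε`, `η = ε / Wi`, `θ = 1 / Wi`. The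
condition `ε < 1` keeps some viscosity. -/
theorem exists_unique_solvesResidual (hd : 0 < d) {Re Wi ε : ℝ} (hRe : 0 ≤ Re) (hWi : 0 < Wi)
    (hε0 : 0 ≤ ε) (hε1 : ε < 1) (u₀ : M.velocitySpace) (σ₀ : M.stressSpace) (hσ₀ : M.IsSPD σ₀)
    (J : M.stressSpace →ₗ[ℝ] M.stressSpace →ₗ[ℝ] ℝ) (f : ℝ → M.stressSpace →ₗ[ℝ] ℝ)
    (hf : ∀ φ, Tendsto (fun T => f T φ) (𝓝[≥] 0)
      (𝓝 (∫ x in M.domain, ddot (M.stressField σ₀ x) (M.stressField φ x)))) :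
    ∃ c₀ : ℝ, 0 < c₀ ∧ ∀ T, 0 ≤ T → T < c₀ → (0 < T ∨ 0 < Re) →
      ∃! w : M.velocitySpace × M.stressSpace,
        M.IsSPD w.2 ∧ M.SolvesResidual Re Wi ε T u₀ (f T) J w.1 w.2 := by
  obtain ⟨m₀, hm₀⟩ := exists_massForm M
  obtain ⟨a₀, ha₀⟩ := exists_dirichletForm M
  obtain ⟨c₁, hc₁⟩ := exists_convectForm u₀
  obtain ⟨b₀, hb₀⟩ := exists_couplingForm M
  obtain ⟨B₀, hB₀⟩ := exists_upperConvectedForm M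
  obtain ⟨g, hg⟩ := exists_stressForm M
  obtain ⟨r, hr, hball⟩ := exists_isSPD_of_abs_sub_le hσ₀
  obtain ⟨K, hK, hKle⟩ := exists_integral_ddot_self_le M
  let ι : M.divFree →ₗ[ℝ] M.velocitySpace := M.divFree.subtype
  obtain ⟨m, hm⟩ : ∃ m : M.divFree →ₗ[ℝ] M.divFree →ₗ[ℝ] ℝ, ∀ v w, m v w =
      ∫ x in M.domain, inner ℝ (v.1.1 x) (w.1.1 x) := ⟨m₀.compl₁₂ ι ι, fun v w => hm₀ v.1 w.1⟩
  obtain ⟨ℓ, hℓ⟩ : ∃ ℓ : M.divFree →ₗ[ℝ] ℝ, ∀ v, ℓ v =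
      ∫ x in M.domain, inner ℝ (u₀.1 x) (v.1.1 x) := ⟨m₀ u₀ ∘ₗ ι, fun v => hm₀ u₀ v.1⟩
  obtain ⟨a, ha⟩ : ∃ a : M.divFree →ₗ[ℝ] M.divFree →ₗ[ℝ] ℝ, ∀ v w, a v w =
      ∫ x in M.domain, ddot (grad v.1.1 x) (grad w.1.1 x) :=
    ⟨a₀.compl₁₂ ι ι, fun v w => ha₀ v.1 w.1⟩
  obtain ⟨c, hc⟩ : ∃ c : M.divFree →ₗ[ℝ] M.divFree →ₗ[ℝ] ℝ, ∀ v w, c v w =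
      ∫ x in M.domain, inner ℝ (convect u₀.1 v.1.1 x) (w.1.1 x) :=
    ⟨c₁.compl₁₂ ι ι, fun v w => hc₁ v.1 w.1⟩
  obtain ⟨b, hb⟩ : ∃ b : M.stressSpace →ₗ[ℝ] M.divFree →ₗ[ℝ] ℝ, ∀ σ v, b σ v =
      ∫ x in M.domain, ddot (M.stressField σ x) (grad v.1.1 x) :=
    ⟨b₀.compl₁₂ LinearMap.id ι, fun σ v => hb₀ σ v.1⟩
  obtain ⟨B, hB⟩ : ∃ B : M.divFree →ₗ[ℝ] M.stressSpace →ₗ[ℝ] M.stressSpace →ₗ[ℝ] ℝ,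
      ∀ u σ φ, B u σ φ = ∫ x in M.domain, ddot (grad u.1.1 x * M.stressField σ x
        + M.stressField σ x * (grad u.1.1 x)ᵀ) (M.stressField φ x) :=
    ⟨B₀ ∘ₗ ι, fun u σ φ => hB₀ u.1 σ φ⟩
  let F : M.cells × Fin d × Fin d → M.stressSpace →ₗ[ℝ] ℝ := fun k =>
    { toFun := fun σ => σ.1 k.1 k.2.1 k.2.2
      map_add' := fun _ _ => rfl
      map_smul' := fun _ _ => rfl }
  have ha_symm : ∀ v w, a v w = a w v := fun v w => by
    rw [ha, ha]
    simp only [ddot_comm]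
  have ha0 : ∀ v, 0 ≤ a v v := fun v => by
    rw [ha]
    exact integral_nonneg fun x => ddot_self_nonneg _
  have ha1 : ∀ v, a v v = 0 → v = 0 := fun v hv => by
    rw [ha] at hv
    exact Subtype.ext (eq_zero_of_dirichletForm hd _ hv)
  have hg_symm : ∀ σ τ, g σ τ = g τ σ := fun σ τ => by
    rw [hg, hg]
    simp only [ddot_comm]
  have hg0 : ∀ σ, 0 ≤ g σ σ := fun σ => by
    rw [hg]
    exact integral_nonneg fun x => ddot_self_nonneg _
  have hg1 : ∀ σ, g σ σ = 0 → σ = 0 := fun σ hσ => eq_zero_of_stressForm σ (by rw [← hg, hσ])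
  have hm1 : ∀ v, v ≠ 0 → 0 < m v v := fun v hv => by
    rw [hm]
    exact massForm_pos _ fun h => hv (Subtype.ext h)
  have hBe : ∀ v σ, B v σ M.unitStress = 2 * b σ v := fun v σ => by
    rw [hB, hb, ← integral_const_mul]
    refine M.setIntegral_congr_openCell fun s hs x hx => ?_
    rw [stressField_unitStress hs hx]
    exact ddot_upperConvected_one _ _ (stressField_isSymm σ x)
  have hge : ∀ σ, g σ M.unitStress = ∫ x in M.domain, (M.stressField σ x).trace := fun σ => by
    rw [hg, integral_ddot_unitStress_right]
  have hgK : ∀ σ, M.IsSPD σ → g σ σ ≤ (K * g σ M.unitStress) ^ 2 := fun σ hσ => by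
    rw [hge, hg]
    exact hKle σ hσ
  have hge0 : ∀ σ, M.IsSPD σ → 0 ≤ g σ M.unitStress := fun σ hσ => by
    rw [hge]
    exact integral_nonneg (trace_stressField_nonneg hσ)
  have hF : ∀ σ, (∀ k, |F k (σ - σ₀)| ≤ r) → M.IsSPD σ := fun σ hσ =>
    hball σ fun s i j => hσ (s, i, j)
  have hfg : ∀ φ, Tendsto (fun T => f T φ) (𝓝[≥] 0) (𝓝 (g σ₀ φ)) := fun φ => by
    rw [hg]
    exact hf φ
  obtain ⟨c₀, hc₀, h⟩ := exists_unique_step_of_forms (V := M.divFree)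
    (S := M.stressSpace) a ha_symm ha0 ha1 g hg_symm hg0 hg1 m c hm1 ℓ b B M.unitStress hBe J {σ | M.IsSPD σ} σ₀ F hr hF hK hgK hge0 f hfg hRe (sub_pos.2 hε1)
    (div_nonneg hε0 hWi.le) (one_div_nonneg.2 hWi.le)
  refine ⟨c₀, hc₀, fun T hT hTc hTR => ?_⟩
  have hres : ∀ (u v : M.divFree) (σ φ : M.stressSpace),
      Re * (m u v - ℓ v) + (g σ φ - f T φ)
        + T * (Re * c u v + (1 - ε) * a u v + ε / Wi * b σ v
          - B u σ φ + 1 / Wi * (g σ φ - g M.unitStress φ) + J σ φ)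
        = M.residual Re Wi ε T u₀ (f T) J u.1 σ v.1 φ := fun u v σ φ => by
    simp only [hm, hℓ, ha, hc, hb, hB, hg, residual, spaceForm]
  obtain ⟨⟨u, σ⟩, ⟨hσ, hu⟩, huniq⟩ := h T hT hTc hTR
  simp only [hres] at hu huniq
  refine ⟨(u.1, σ), ⟨hσ, u.2, fun v φ hv => hu ⟨v, hv⟩ φ⟩, ?_⟩
  rintro ⟨u', σ'⟩ ⟨hσ', hu', h'⟩
  have := huniq (⟨u', hu'⟩, σ') ⟨hσ', fun v φ => h' v.1 φ v.2⟩
  rw [Prod.mk.injEq] at this ⊢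
  exact ⟨congrArg Subtype.val this.1, this.2⟩

/-- For a positive time step, the pressure can be recovered from the pressure-free scheme. -/
theorem exists_pressure_iff_solvesResidual {Re Wi ε T : ℝ} (hT : 0 < T) (u₀ : M.velocitySpace)
    (f : M.stressSpace →ₗ[ℝ] ℝ) (J : M.stressSpace →ₗ[ℝ] M.stressSpace →ₗ[ℝ] ℝ)
    (u : M.velocitySpace) (σ : M.stressSpace) :
    (∃ p : M.PressureSpace, ∀ (v : M.velocitySpace) (q : M.PressureSpace) (φ : M.stressSpace),
      M.residual Re Wi ε T u₀ f J u σ v φ / T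
        + (-(∫ x in M.domain, M.pressureField p x * divergence v.1 x)
        + ∫ x in M.domain, M.pressureField q x * divergence u.1 x) = 0) ↔
      M.SolvesResidual Re Wi ε T u₀ f J u σ := by
  obtain ⟨m, hm⟩ := exists_massForm M
  obtain ⟨a, ha⟩ := exists_dirichletForm M
  obtain ⟨c, hc⟩ := exists_convectForm u₀
  obtain ⟨b, hb⟩ := exists_couplingForm M
  obtain ⟨B, hB⟩ := exists_upperConvectedForm M
  obtain ⟨g, hg⟩ := exists_stressForm M
  obtain ⟨D, hD⟩ := exists_divergenceForm M
  -- the residual is the sum of a linear form in `v` and a linear form in `φ`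
  let R₁ : M.velocitySpace →ₗ[ℝ] ℝ := Re • (m u - m u₀)
    + T • (Re • c u + (1 - ε) • a u + (ε / Wi) • b σ)
  let R₂ : M.stressSpace →ₗ[ℝ] ℝ := g σ - f + T • (-B u σ + (1 / Wi) • (g σ - g M.unitStress) + J σ)
  have hR : ∀ v φ, M.residual Re Wi ε T u₀ f J u σ v φ = R₁ v + R₂ φ := fun v φ => by
    simp only [residual, spaceForm, ← hm, ← ha, ← hc, ← hb, ← hB, ← hg, R₁, R₂,
      LinearMap.add_apply, LinearMap.sub_apply, LinearMap.smul_apply, LinearMap.neg_apply,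
      smul_eq_mul]
    ring
  simp only [SolvesResidual, IsDivFree, hR, ← hD]
  constructor
  · rintro ⟨p, hp⟩
    refine ⟨fun q => by simpa using hp 0 q 0, fun v φ hv => ?_⟩
    have h := hp v 0 φ
    rw [hv p, map_zero, LinearMap.zero_apply, neg_zero, add_zero, add_zero, div_eq_zero_iff] at h
    exact h.resolve_right hT.ne'
  · rintro ⟨hu, h⟩
    have hR₁ : ∀ v, M.IsDivFree v → R₁ v = 0 := fun v hv => by
      simpa using h v 0 fun q => by rw [hD, hv q]
    have hR₂ : ∀ φ, R₂ φ = 0 := fun φ => by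
      simpa using h 0 φ fun q => map_zero _
    obtain ⟨p, hp⟩ := exists_pressure_of_forall_isDivFree ((1 / T) • R₁)
      fun v hv => by simp [hR₁ v hv]
    refine ⟨p, fun v q φ => ?_⟩
    have hpv := hp v
    rw [← hD, LinearMap.smul_apply, smul_eq_mul] at hpv
    rw [hu q, hR₂, ← hpv]
    ring

/-- Since `f` represents the transported stress for every backward flow, the flow in the definition
of a solution can be exchanged for any other, and one exists. -/
theorem solvesCharacteristicProj_iff {Re Wi ε T : ℝ} (hT : 0 ≤ T) (u₀ : M.velocitySpace)
    (σ₀ : M.stressSpace) {f : M.stressSpace →ₗ[ℝ] ℝ}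
    (hf : ∀ X, M.IsBackwardFlow u₀.1 T X → ∀ φ,
      IntegrableOn (fun x => ddot (M.stressField σ₀ (X 0 x)) (M.stressField φ x)) M.domain ∧
      f φ = ∫ x in M.domain, ddot (M.stressField σ₀ (X 0 x)) (M.stressField φ x))
    (u : M.velocitySpace) (σ : M.stressSpace) :
    M.SolvesCharacteristicProj Re Wi ε T u₀ σ₀ u σ ↔
      M.SolvesResidual Re Wi ε T u₀ f 0 u σ := by
  have key : ∀ X, M.IsBackwardFlow u₀.1 T X → ∀ (v : M.velocitySpace) (φ : M.stressSpace),
      ∫ x in M.domain,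
        (timeDensity Re u₀.1 u.1 v.1 (fun y => M.stressField σ₀ (X 0 y)) (M.stressField σ)
            (M.stressField φ) x
          + T * spaceDensity Re Wi ε u₀.1 u.1 v.1 (M.stressField σ) (M.stressField φ) x) =
        M.residual Re Wi ε T u₀ f 0 u σ v φ := fun X hX v φ => by
    rw [((hasDomainIntegral_timeDensity Re u₀ u v σ φ ⟨(hf X hX φ).1, (hf X hX φ).2.symm⟩).add
      ((hasDomainIntegral_spaceDensity Re Wi ε u₀ u v σ φ).const_mul T)).2, residual]
    simp
  obtain ⟨X, hX, -⟩ := exists_isBackwardFlow u₀ hT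
  refine and_congr_right fun _ => ⟨fun ⟨Y, hY, h⟩ v φ hv => ?_, fun h => ⟨X, hX, fun v φ hv => ?_⟩⟩
  · rw [← key Y hY, h v φ hv]
  · rw [key X hX, h v φ hv]

theorem exists_solvesCharacteristic_iff {Re Wi ε T : ℝ} (hT : 0 < T) (u₀ : M.velocitySpace)
    (σ₀ : M.stressSpace) {f : M.stressSpace →ₗ[ℝ] ℝ}
    (hf : ∀ X, M.IsBackwardFlow u₀.1 T X → ∀ φ,
      IntegrableOn (fun x => ddot (M.stressField σ₀ (X 0 x)) (M.stressField φ x)) M.domain ∧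
      f φ = ∫ x in M.domain, ddot (M.stressField σ₀ (X 0 x)) (M.stressField φ x))
    (u : M.velocitySpace) (σ : M.stressSpace) :
    (∃ p, M.SolvesCharacteristic Re Wi ε T u₀ σ₀ u p σ) ↔
      M.SolvesResidual Re Wi ε T u₀ f 0 u σ := by
  have key : ∀ X, M.IsBackwardFlow u₀.1 T X → ∀ (p : M.PressureSpace) (v : M.velocitySpace)
      (q : M.PressureSpace) (φ : M.stressSpace),
      ∫ x in M.domain,
        (timeDensity Re u₀.1 u.1 v.1 (fun y => M.stressField σ₀ (X 0 y)) (M.stressField σ)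
            (M.stressField φ) x / T
          + spaceDensity Re Wi ε u₀.1 u.1 v.1 (M.stressField σ) (M.stressField φ) x
          + pressureDensity (M.pressureField p) (M.pressureField q) u.1 v.1 x) =
        M.residual Re Wi ε T u₀ f 0 u σ v φ / T
        + (-(∫ x in M.domain, M.pressureField p x * divergence v.1 x)
        + ∫ x in M.domain, M.pressureField q x * divergence u.1 x) := fun X hX p v q φ => by
    rw [((((hasDomainIntegral_timeDensity Re u₀ u v σ φ
      ⟨(hf X hX φ).1, (hf X hX φ).2.symm⟩).div_const T).add
      (hasDomainIntegral_spaceDensity Re Wi ε u₀ u v σ φ)).add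
      (hasDomainIntegral_pressureDensity p q u v)).2, residual, LinearMap.zero_apply,
      LinearMap.zero_apply, add_zero, add_div _ (T * _), mul_div_cancel_left₀ _ hT.ne']
  rw [← exists_pressure_iff_solvesResidual hT]
  obtain ⟨X, hX, -⟩ := exists_isBackwardFlow u₀ hT.le
  refine exists_congr fun p => ⟨fun ⟨Y, hY, h⟩ v q φ => ?_, fun h => ⟨X, hX, fun v q φ => ?_⟩⟩
  · rw [← key Y hY, h v q φ]
  · rw [key X hX, h v q φ]

theorem solvesDGProj_iff {Re Wi ε T : ℝ} (u₀ : M.velocitySpace)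
    (σ₀ : M.stressSpace) {f : M.stressSpace →ₗ[ℝ] ℝ}
    (hf : ∀ φ, f φ = ∫ x in M.domain, ddot (M.stressField σ₀ x) (M.stressField φ x))
    {J : M.stressSpace →ₗ[ℝ] M.stressSpace →ₗ[ℝ] ℝ} (hJ : ∀ σ φ, J σ φ = M.jumpTerm u₀ σ φ)
    (u : M.velocitySpace) (σ : M.stressSpace) :
    M.SolvesDGProj Re Wi ε T u₀ σ₀ u σ ↔ M.SolvesResidual Re Wi ε T u₀ f J u σ := by
  refine and_congr_right fun _ => forall₂_congr fun v φ => imp_congr_right fun _ => ?_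
  rw [((hasDomainIntegral_timeDensity Re u₀ u v σ φ (hasDomainIntegral_stress σ₀ φ)).add
    ((hasDomainIntegral_spaceDensity Re Wi ε u₀ u v σ φ).const_mul T)).2, ← hf, residual, ← hJ,
    mul_add, add_assoc _ (T * _) (T * _)]

theorem exists_solvesDG_iff {Re Wi ε T : ℝ} (hT : 0 < T) (u₀ : M.velocitySpace)
    (σ₀ : M.stressSpace) {f : M.stressSpace →ₗ[ℝ] ℝ}
    (hf : ∀ φ, f φ = ∫ x in M.domain, ddot (M.stressField σ₀ x) (M.stressField φ x))
    {J : M.stressSpace →ₗ[ℝ] M.stressSpace →ₗ[ℝ] ℝ} (hJ : ∀ σ φ, J σ φ = M.jumpTerm u₀ σ φ)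
    (u : M.velocitySpace) (σ : M.stressSpace) :
    (∃ p, M.SolvesDG Re Wi ε T u₀ σ₀ u p σ) ↔ M.SolvesResidual Re Wi ε T u₀ f J u σ := by
  rw [← exists_pressure_iff_solvesResidual hT]
  refine exists_congr fun p => forall₃_congr fun v q φ => ?_
  rw [((((hasDomainIntegral_timeDensity Re u₀ u v σ φ (hasDomainIntegral_stress σ₀ φ)).div_const
    T).add (hasDomainIntegral_spaceDensity Re Wi ε u₀ u v σ φ)).add
    (hasDomainIntegral_pressureDensity p q u v)).2, ← hf, residual, ← hJ, add_div _ (T * _),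
    mul_div_cancel_left₀ _ hT.ne']
  refine Eq.congr ?_ rfl
  ring

end Mesh

end OldroydB

end

/-! ### The two methods -/

theorem mainTheorem10 (d : ℕ) (hd : d = 2 ∨ d = 3) (M : OldroydB.Mesh d)
    (Re Wi ε : ℝ) (hRe : 0 ≤ Re) (hWi : 0 < Wi) (hε0 : 0 ≤ ε) (hε1 : ε < 1)
    (u₀ : M.velocitySpace) (σ₀ : M.stressSpace) (hσ₀ : M.IsSPD σ₀) :
    (∃ c₀ : ℝ, 0 < c₀ ∧ ∀ Δt : ℝ, 0 ≤ Δt → Δt < c₀ →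
      (0 < Δt → ∃! w : M.velocitySpace × M.stressSpace,
        M.IsSPD w.2 ∧
          ∃ p : M.PressureSpace, M.SolvesCharacteristic Re Wi ε Δt u₀ σ₀ w.1 p w.2) ∧
      (0 < Δt ∨ 0 < Re → ∃! w : M.velocitySpace × M.stressSpace,
        M.IsSPD w.2 ∧ M.SolvesCharacteristicProj Re Wi ε Δt u₀ σ₀ w.1 w.2)) ∧
    (∃ c₀ : ℝ, 0 < c₀ ∧ ∀ Δt : ℝ, 0 ≤ Δt → Δt < c₀ →
      (0 < Δt → ∃! w : M.velocitySpace × M.stressSpace,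
        M.IsSPD w.2 ∧
          ∃ p : M.PressureSpace, M.SolvesDG Re Wi ε Δt u₀ σ₀ w.1 p w.2) ∧
      (0 < Δt ∨ 0 < Re → ∃! w : M.velocitySpace × M.stressSpace,
        M.IsSPD w.2 ∧ M.SolvesDGProj Re Wi ε Δt u₀ σ₀ w.1 w.2)) := by
  have hd0 : 0 < d := by omega
  constructor
  · obtain ⟨f, hf, hlim⟩ := OldroydB.Mesh.exists_transportForm u₀ σ₀
    obtain ⟨c₀, hc₀, h⟩ := OldroydB.Mesh.exists_unique_solvesResidual hd0 hRe hWi hε0 hε1 u₀ σ₀ hσ₀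
      0 f hlim
    refine ⟨c₀, hc₀, fun T hT hTc => ⟨fun hT0 => ?_, fun hTR => ?_⟩⟩
    · simp only [OldroydB.Mesh.exists_solvesCharacteristic_iff hT0 u₀ σ₀ (hf T hT)]
      exact h T hT hTc (Or.inl hT0)
    · simp only [OldroydB.Mesh.solvesCharacteristicProj_iff hT u₀ σ₀ (hf T hT)]
      exact h T hT hTc hTR
  · obtain ⟨J, hJ⟩ := OldroydB.Mesh.exists_jumpForm hd0 u₀
    obtain ⟨g, hg⟩ := OldroydB.Mesh.exists_stressForm M
    -- Without transport the previous stress enters through a form independent of the step length,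
    -- so its limit is trivial.
    obtain ⟨c₀, hc₀, h⟩ := OldroydB.Mesh.exists_unique_solvesResidual hd0 hRe hWi hε0 hε1 u₀ σ₀ hσ₀
      J (fun _ => g σ₀) (fun φ => by
        rw [← hg]
        exact tendsto_const_nhds)
    refine ⟨c₀, hc₀, fun T hT hTc => ⟨fun hT0 => ?_, fun hTR => ?_⟩⟩
    · simp only [OldroydB.Mesh.exists_solvesDG_iff hT0 u₀ σ₀ (hg σ₀) hJ]
      exact h T hT hTc (Or.inl hT0)
    · simp only [OldroydB.Mesh.solvesDGProj_iff u₀ σ₀ (hg σ₀) hJ]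
      exact h T hT hTc hTR
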